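/- Let $\Omega\subset\mathbb R^d$ be a bounded domain (nonempty, open, connected) with $C^\infty$ boundary, let $T>0$ and let $k\ge 0$ be an integer. Then there is a constant $C>0$, depending only on $d$, $\Omega$, $T$ and $k$, with the following property. Let $\sigma\in C^\infty(\mathbb R)$ be any activation function that is not a polynomial, let $f\in C^{k+1}([0,T]\times\overline\Omega)$, and let $N\ge 1$ be an integer. Then there is a function $\phi_N$ represented by a deep feedforward neural network with activation $\sigma$ (with $d+1$ inputs $(t,x)$, one real output, an affine output layer and at least two hidden layers) of complexity $N$, meaning that exactly $N$ of its weights and biases are nonzero, such that $$\|f-\phi_N\|_{W^{k,\infty}([0,T]\times\overline\Omega)}\le \frac{C}{N^{\frac1{d+1}}}\,\|f\|_{W^{k+1,\infty}([0,T]\times\overline\Omega)} .$$ Here $\|u\|_{W^{j,\infty}([0,T]\times\overline\Omega)}=\max_{|\alpha|\le j}\|D^\alpha u\|_{L^\infty((0,T)\times\Omega)}$, where $\alpha$ runs over the space-time multi-indices of order at most $j$ and $D^\alpha$ is the weak derivative. -/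

import Mathlib

open Set MeasureTheory
open scoped ContDiff ENNReal Topology

/-- A point `(t, x)` of space-time `ℝ × ℝ^d`. -/
abbrev SpaceTime (d : ℕ) : Type := ℝ × EuclideanSpace ℝ (Fin d)

/-- A bounded domain (nonempty, open, connected) of `ℝ^d` with `C^∞` boundary: near each boundary
point, `Ω` is the sublevel set `{ρ < 0}` of a smooth function whose differential does not vanish at
that point. -/
structure IsSmoothBoundedDomain {d : ℕ} (Ω : Set (EuclideanSpace ℝ (Fin d))) : Prop where
  isOpen : IsOpen Ω
  isConnected : IsConnected Ω
  isBounded : Bornology.IsBounded Ω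
  smooth_boundary : ∀ x ∈ frontier Ω, ∃ U : Set (EuclideanSpace ℝ (Fin d)), IsOpen U ∧ x ∈ U ∧
    ∃ ρ : EuclideanSpace ℝ (Fin d) → ℝ, ContDiffOn ℝ ∞ ρ U ∧ fderiv ℝ ρ x ≠ 0 ∧
      Ω ∩ U = {y ∈ U | ρ y < 0}

/-- The coordinate directions of space-time: direction `0` is time, direction `i + 1` is the `i`-th
space coordinate. -/
noncomputable def coordDir (d : ℕ) : Fin (d + 1) → SpaceTime d :=
  Fin.cons (1, 0) (fun i => (0, EuclideanSpace.single i 1))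

/-- `v` is the weak partial derivative `∂_{ι 0} ⋯ ∂_{ι (n-1)} u` of `u` on the open set `Q`. A
multi-index of order `n` is given by a tuple `ι` listing its `n` coordinate directions. -/
def IsWeakDeriv {d : ℕ} (Q : Set (SpaceTime d)) {n : ℕ} (ι : Fin n → Fin (d + 1))
    (u v : SpaceTime d → ℝ) : Prop :=
  LocallyIntegrableOn u Q volume ∧ LocallyIntegrableOn v Q volume ∧
    ∀ η : SpaceTime d → ℝ, ContDiff ℝ ∞ η → HasCompactSupport η → tsupport η ⊆ Q →
      ∫ z in Q, u z * iteratedFDeriv ℝ n η z (fun i => coordDir d (ι i)) =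
        (-1) ^ n * ∫ z in Q, v z * η z

/-- The `W^{k,∞}(Q)` norm `max_{|α| ≤ k} ‖D^α u‖_{L^∞(Q)}`, with weak derivatives `D^α u`. Weak
derivatives are unique up to null sets, so the infimum is over at most one class; it is `∞` if the
weak derivative does not exist. -/
noncomputable def sobolevNorm {d : ℕ} (k : ℕ) (Q : Set (SpaceTime d)) (u : SpaceTime d → ℝ) :
    ℝ≥0∞ :=
  ⨆ (n : ℕ) (_ : n ≤ k) (ι : Fin n → Fin (d + 1)),
    ⨅ (v : SpaceTime d → ℝ) (_ : IsWeakDeriv Q ι u v), eLpNorm v ∞ (volume.restrict Q)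

/-- Fully connected feedforward neural networks with `n` inputs and one real output: finitely many
hidden layers, each with a weight matrix and a bias vector, and then an affine output layer. -/
inductive NeuralNetwork : ℕ → Type
  | output {n : ℕ} (w : Fin n → ℝ) (b : ℝ) : NeuralNetwork n
  | hidden {n m : ℕ} (W : Matrix (Fin m) (Fin n) ℝ) (b : Fin m → ℝ) (rest : NeuralNetwork m) :
      NeuralNetwork n

namespace NeuralNetwork

/-- The function realized by a network with activation function `σ`, applied componentwise in
every hidden layer. -/
def eval (σ : ℝ → ℝ) : {n : ℕ} → NeuralNetwork n → (Fin n → ℝ) → ℝ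
  | _, output w b, x => w ⬝ᵥ x + b
  | _, hidden W b rest, x => rest.eval σ (fun i => σ (W.mulVec x i + b i))

/-- The number of hidden layers. -/
def depth : {n : ℕ} → NeuralNetwork n → ℕ
  | _, output _ _ => 0
  | _, hidden _ _ rest => rest.depth + 1

/-- The complexity of a network: the total number of its nonzero weights and biases. -/
noncomputable def complexity : {n : ℕ} → NeuralNetwork n → ℕ
  | _, output w b => Set.ncard {j | w j ≠ 0} + (open Classical in if b = 0 then 0 else 1)
  | _, hidden W b rest =>
      Set.ncard {p : _ × _ | W p.1 p.2 ≠ 0} + Set.ncard {i | b i ≠ 0} + rest.complexity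

/-- The function of `(t, x) = (t, x_1, …, x_d)` realized by a network with `d + 1` inputs. -/
def realize {d : ℕ} (σ : ℝ → ℝ) (Φ : NeuralNetwork (d + 1)) (z : SpaceTime d) : ℝ :=
  Φ.eval σ (Fin.cons z.1 (fun i => z.2 i))

end NeuralNetwork

/-! Polynomials do the approximating, and networks imitate polynomials at a cost that does not
depend on `σ`. By Jackson's theorem (`BoundedDerivs.exists_polynomial_approx`), a compactly
supported function with `k + 1` bounded derivatives is within `O(1 / n)`, together with its
derivatives up to order `k`, of a polynomial of degree at most `8 n` in each of the `d + 1`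
coordinates. The polynomial is a convolution with a product of one-dimensional kernels built from
`(T_{2n+1}(x) / x) ^ 4`.

A smooth non-polynomial `σ` has a point `b₀` where all derivatives up to a prescribed order are
nonzero. Finite differences, in the integer vector `β`, of `σ (b₀ + ε β · z)`, divided by a power of
`ε`, then tend to any chosen monomial as `ε → 0`. The same `(8 n + 1) ^ (d + 1)` neurons serve all
monomials (`exists_approx_polynomial`). The size of the weights depends on `σ`, but their number
does not: about `n ^ (d + 1)` parameters give error `O(1 / n)`, which is the rate `N ^ (-1 / (d +
1))`. One more neuron imitating the identity supplies the second hidden layer, and inert biases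
bring the count to exactly `N` (`exists_network_of_le`).

Jackson's theorem needs a function on all of space-time. The extension
(`IsSmoothBoundedDomain.exists_extension`) uses reflections in the manner of Hestenes: across the
boundary, `f` is replaced by a weighted sum of its values at several reflected points, with moment
conditions on the weights that make the derivatives match. This is done locally at the boundary of
`Ω`, then at the two ends of the time interval, and a cutoff follows.

All estimates are made for `BoundedDerivs`, which only measures iterated partial derivatives along
fixed directions, so that the product and chain rules become inductions on the order.
`boundedDerivs_of_sobolevNorm_le` and `BoundedDerivs.sobolevNorm_le` translate from and to the weak
Sobolev norm without loss of constants. -/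

/-! ### Functions with bounded derivatives along a family of directions -/

section BoundedDerivs

variable {V : Type*} [NormedAddCommGroup V] [NormedSpace ℝ V] {ι : Type*}

/-- `f` is `m` times differentiable within `S`, and all its iterated partial derivatives of order at
most `m` along the directions `dir i` are continuous on `S` and bounded there by `M`. -/
def BoundedDerivs (dir : ι → V) (S : Set V) (M : ℝ) : ℕ → (V → ℝ) → Prop
  | 0, f => ContinuousOn f S ∧ ∀ x ∈ S, |f x| ≤ M
  | m + 1, f => (∀ x ∈ S, |f x| ≤ M) ∧ ∃ f' : V → V →L[ℝ] ℝ,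
      (∀ x ∈ S, HasFDerivWithinAt f (f' x) S x) ∧
        ∀ i, BoundedDerivs dir S M m (fun x => f' x (dir i))

namespace BoundedDerivs

variable {dir : ι → V} {S S' : Set V} {M M' A : ℝ} {m : ℕ} {f g : V → ℝ}

theorem abs_le (h : BoundedDerivs dir S M m f) : ∀ x ∈ S, |f x| ≤ M := by
  cases m with
  | zero => exact h.2
  | succ m => exact h.1

theorem continuousOn (h : BoundedDerivs dir S M m f) : ContinuousOn f S := by
  cases m with
  | zero => exact h.1
  | succ m =>
    obtain ⟨_, f', hf', _⟩ := h
    exact fun x hx => (hf' x hx).continuousWithinAt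

theorem mono_bound (h : BoundedDerivs dir S M m f) (hM : M ≤ M') : BoundedDerivs dir S M' m f := by
  induction m generalizing f with
  | zero => exact ⟨h.1, fun x hx => (h.2 x hx).trans hM⟩
  | succ m ih =>
    obtain ⟨h0, f', hf', hi⟩ := h
    exact ⟨fun x hx => (h0 x hx).trans hM, f', hf', fun i => ih (hi i)⟩

theorem mono_set (h : BoundedDerivs dir S M m f) (hS : S' ⊆ S) : BoundedDerivs dir S' M m f := by
  induction m generalizing f with
  | zero => exact ⟨h.1.mono hS, fun x hx => h.2 x (hS hx)⟩
  | succ m ih =>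
    obtain ⟨h0, f', hf', hi⟩ := h
    exact ⟨fun x hx => h0 x (hS hx), f', fun x hx => (hf' x (hS hx)).mono hS, fun i => ih (hi i)⟩

theorem pred (h : BoundedDerivs dir S M (m + 1) f) : BoundedDerivs dir S M m f := by
  induction m generalizing f with
  | zero => exact ⟨h.continuousOn, h.abs_le⟩
  | succ m ih =>
    obtain ⟨h0, f', hf', hi⟩ := h
    exact ⟨h0, f', hf', fun i => ih (hi i)⟩

theorem congr (h : BoundedDerivs dir S M m f) (hfg : EqOn g f S) : BoundedDerivs dir S M m g := by
  cases m with
  | zero => exact ⟨h.1.congr hfg, fun x hx => by rw [hfg hx]; exact h.2 x hx⟩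
  | succ m =>
    obtain ⟨h0, f', hf', hi⟩ := h
    exact ⟨fun x hx => by rw [hfg hx]; exact h0 x hx, f',
      fun x hx => (hf' x hx).congr hfg (hfg hx), hi⟩

theorem const (c : ℝ) (hc : |c| ≤ M) : BoundedDerivs dir S M m (fun _ => c) := by
  have hM : 0 ≤ M := (abs_nonneg c).trans hc
  induction m generalizing c with
  | zero => exact ⟨continuousOn_const, fun _ _ => hc⟩
  | succ m ih =>
    exact ⟨fun _ _ => hc, fun _ => 0, fun x _ => hasFDerivWithinAt_const c x S,
      fun i => by simpa using ih 0 (by simpa using hM)⟩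

theorem add (hf : BoundedDerivs dir S M m f) (hg : BoundedDerivs dir S A m g) :
    BoundedDerivs dir S (M + A) m (fun x => f x + g x) := by
  induction m generalizing f g with
  | zero =>
    exact ⟨hf.1.add hg.1, fun x hx => (abs_add_le _ _).trans (add_le_add (hf.2 x hx) (hg.2 x hx))⟩
  | succ m ih =>
    obtain ⟨f0, f', hf', fi⟩ := hf
    obtain ⟨g0, g', hg', gi⟩ := hg
    exact ⟨fun x hx => (abs_add_le _ _).trans (add_le_add (f0 x hx) (g0 x hx)),
      fun x => f' x + g' x, fun x hx => (hf' x hx).add (hg' x hx), fun i => ih (fi i) (gi i)⟩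

theorem const_mul (hf : BoundedDerivs dir S M m f) (c : ℝ) :
    BoundedDerivs dir S (|c| * M) m (fun x => c * f x) := by
  induction m generalizing f with
  | zero =>
    exact ⟨continuousOn_const.mul hf.1, fun x hx => by
      rw [abs_mul]; exact mul_le_mul_of_nonneg_left (hf.2 x hx) (abs_nonneg c)⟩
  | succ m ih =>
    obtain ⟨f0, f', hf', fi⟩ := hf
    exact ⟨fun x hx => by
      rw [abs_mul]; exact mul_le_mul_of_nonneg_left (f0 x hx) (abs_nonneg c),
      fun x => c • f' x, fun x hx => (hf' x hx).const_mul c, fun i => ih (fi i)⟩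

theorem neg (hf : BoundedDerivs dir S M m f) : BoundedDerivs dir S M m (fun x => -f x) := by
  simpa using hf.const_mul (-1)

theorem sub (hf : BoundedDerivs dir S M m f) (hg : BoundedDerivs dir S A m g) :
    BoundedDerivs dir S (M + A) m (fun x => f x - g x) := by
  simpa [sub_eq_add_neg] using hf.add hg.neg

theorem sum {κ : Type*} (s : Finset κ) {F : κ → V → ℝ} {B : κ → ℝ}
    (h : ∀ j ∈ s, BoundedDerivs dir S (B j) m (F j)) :
    BoundedDerivs dir S (∑ j ∈ s, B j) m (fun x => ∑ j ∈ s, F j x) := by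
  classical
  induction s using Finset.induction_on with
  | empty => simpa using const (dir := dir) (S := S) (m := m) (M := 0) 0 (by simp)
  | insert a s ha ih =>
    simp only [Finset.sum_insert ha]
    exact (h a (Finset.mem_insert_self a s)).add
      (ih fun j hj => h j (Finset.mem_insert_of_mem hj))

/-- Leibniz's rule produces two products of order one lower, so the constant doubles with each
order. -/
theorem mul (hM : 0 ≤ M) (hA : 0 ≤ A) (hf : BoundedDerivs dir S M m f)
    (hg : BoundedDerivs dir S A m g) :
    BoundedDerivs dir S (2 ^ m * (M * A)) m (fun x => f x * g x) := by
  induction m generalizing f g with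
  | zero =>
    exact ⟨hf.1.mul hg.1, fun x hx => by
      rw [abs_mul, pow_zero, one_mul]
      exact mul_le_mul (hf.2 x hx) (hg.2 x hx) (abs_nonneg _) hM⟩
  | succ m ih =>
    have hf₀ := hf.pred
    have hg₀ := hg.pred
    obtain ⟨f0, f', hf', fi⟩ := hf
    obtain ⟨g0, g', hg', gi⟩ := hg
    refine ⟨fun x hx => ?_, fun x => f x • g' x + g x • f' x,
      fun x hx => (hf' x hx).mul (hg' x hx), fun i => ?_⟩
    · rw [abs_mul]
      refine (mul_le_mul (f0 x hx) (g0 x hx) (abs_nonneg _) hM).trans ?_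
      exact le_mul_of_one_le_left (mul_nonneg hM hA) (one_le_pow₀ (by norm_num))
    · have h := (ih hf₀ (gi i)).add (ih (fi i) hg₀)
      refine (h.mono_bound (le_of_eq (by ring))).congr fun x _ => ?_
      simp [mul_comm]

/-- Multiplying by a smooth cutoff supported in the open set `U` turns bounds on `S ∩ U` into bounds
on `S`. -/
theorem cutoff_mul {U : Set V} {χ : V → ℝ} (hM : 0 ≤ M) (hA : 0 ≤ A) (hχU : tsupport χ ⊆ U)
    (hχ : BoundedDerivs dir univ A m χ) (hU : IsOpen U) (hf : BoundedDerivs dir (S ∩ U) M m f) :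
    BoundedDerivs dir S (2 ^ m * (A * M)) m (fun x => χ x * f x) := by
  -- Off `U` nothing is known about `f`, but there the product vanishes in a neighbourhood. This is
  -- stated for all `χ` and `f` so that it survives the induction.
  have hz : ∀ {χ f : V → ℝ}, tsupport χ ⊆ U → ∀ x, x ∉ U →
      (fun y => χ y * f y) =ᶠ[𝓝 x] fun _ => 0 := fun {χ f} hχU x hx => by
    have : x ∉ tsupport χ := fun h => hx (hχU h)
    rw [notMem_tsupport_iff_eventuallyEq] at this
    filter_upwards [this] with y hy
    simp [hy]
  induction m generalizing f χ with
  | zero =>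
    refine ⟨fun x hx => ?_, fun x hx => ?_⟩
    · by_cases hxU : x ∈ U
      · have h1 : ContinuousWithinAt (fun x => χ x * f x) (S ∩ U) x :=
          ((hχ.1.mono (subset_univ _)).mul hf.1) x ⟨hx, hxU⟩
        exact (continuousWithinAt_inter (hU.mem_nhds hxU)).1 h1
      · exact (continuousAt_const.congr (hz hχU x hxU).symm).continuousWithinAt
    · by_cases hxU : x ∈ U
      · rw [abs_mul, pow_zero, one_mul]
        exact mul_le_mul (hχ.2 x trivial) (hf.2 x ⟨hx, hxU⟩) (abs_nonneg _) hA
      · have h0 : χ x * f x = 0 := (hz hχU x hxU).eq_of_nhds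
        simp only [h0, abs_zero]
        positivity
  | succ m ih =>
    have h₀ := ih hχU hχ.pred hf.pred
    have hf₀ := hf.pred
    have hχ₀ := hχ.pred
    obtain ⟨f0, f', hf', fi⟩ := hf
    obtain ⟨χ0, χ', hχ', χi⟩ := hχ
    -- The derivative on the whole space is unique, so the derivatives of `χ` are again supported in
    -- `U` and the induction hypothesis applies to them.
    have hχf : χ' = fderiv ℝ χ := funext fun x =>
      ((hasFDerivWithinAt_univ.1 (hχ' x trivial)).fderiv).symm
    have hsupp : ∀ i, tsupport (fun x => χ' x (dir i)) ⊆ tsupport χ := fun i => by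
      rw [hχf]; exact tsupport_fderiv_apply_subset ℝ (dir i)
    refine ⟨fun x hx => (h₀.abs_le x hx).trans ?_, fun x => χ x • f' x + f x • χ' x,
      fun x hx => ?_, fun i => ?_⟩
    · have : 0 ≤ 2 ^ m * (A * M) := by positivity
      rw [pow_succ]; linarith
    · by_cases hxU : x ∈ U
      · have h1 := ((hχ' x trivial).mono (subset_univ (S ∩ U))).mul (hf' x ⟨hx, hxU⟩)
        exact (hasFDerivWithinAt_inter (hU.mem_nhds hxU)).1 h1
      · have hχz : χ x = 0 := image_eq_zero_of_notMem_tsupport fun h => hxU (hχU h)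
        have hχ'z : χ' x = 0 := by
          rw [hχf]
          exact image_eq_zero_of_notMem_tsupport fun h =>
            hxU (hχU (tsupport_fderiv_subset ℝ h))
        have h0 : χ x • f' x + f x • χ' x = 0 := by
          rw [hχz, hχ'z, zero_smul, smul_zero, add_zero]
        simp only [h0]
        exact ((hasFDerivAt_const (0 : ℝ) x).congr_of_eventuallyEq
          (hz hχU x hxU)).hasFDerivWithinAt
    · have h := (ih hχU hχ₀ (fi i)).add (ih ((hsupp i).trans hχU) (χi i) hf₀)
      refine (h.mono_bound (le_of_eq (by ring))).congr fun x _ => ?_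
      simp [mul_comm]

/-- Bounds on a finite family can be made uniform. -/
theorem exists_uniform_bound [Finite ι] {F : ι → V → ℝ}
    (h : ∀ i, ∃ A, 0 ≤ A ∧ BoundedDerivs dir S A m (F i)) :
    ∃ A, 0 ≤ A ∧ ∀ i, BoundedDerivs dir S A m (F i) := by
  cases nonempty_fintype ι
  choose A hA0 hA using h
  exact ⟨∑ i, A i, Finset.sum_nonneg fun i _ => hA0 i, fun i =>
    (hA i).mono_bound (Finset.single_le_sum (fun i _ => hA0 i) (Finset.mem_univ i))⟩

theorem exists_succ [Finite ι] {B : ℝ} {f' : V → V →L[ℝ] ℝ} (hB : 0 ≤ B)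
    (h0 : ∀ x ∈ S, |f x| ≤ B) (hf' : ∀ x ∈ S, HasFDerivWithinAt f (f' x) S x)
    (h : ∀ i, ∃ A, 0 ≤ A ∧ BoundedDerivs dir S A m (fun x => f' x (dir i))) :
    ∃ A, 0 ≤ A ∧ BoundedDerivs dir S A (m + 1) f := by
  obtain ⟨A, hA, hi⟩ := exists_uniform_bound h
  exact ⟨A + B, by positivity, fun x hx => (h0 x hx).trans (by linarith), f', hf',
    fun i => (hi i).mono_bound (by linarith)⟩

/-- A compactly supported smooth function of a linear image of the variable has bounded
derivatives. -/
theorem exists_of_hasCompactSupport_comp [Finite ι] {W : Type*} [NormedAddCommGroup W]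
    [NormedSpace ℝ W] (L : V →L[ℝ] W) {ψ : W → ℝ} (hψ : ContDiff ℝ ∞ ψ)
    (hc : HasCompactSupport ψ) (m : ℕ) :
    ∃ A, 0 ≤ A ∧ BoundedDerivs dir univ A m (fun x => ψ (L x)) := by
  have hb : ∀ ψ : W → ℝ, ContDiff ℝ ∞ ψ → HasCompactSupport ψ →
      ∃ B, 0 ≤ B ∧ ∀ x ∈ (univ : Set V), |ψ (L x)| ≤ B := fun ψ h1 h2 => by
    obtain ⟨C, hC⟩ := h2.exists_bound_of_continuous h1.continuous
    exact ⟨C, (norm_nonneg _).trans (hC 0), fun x _ => hC (L x)⟩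
  induction m generalizing ψ with
  | zero =>
    obtain ⟨B, hB, h⟩ := hb ψ hψ hc
    exact ⟨B, hB, (hψ.continuous.comp L.continuous).continuousOn, h⟩
  | succ m ih =>
    obtain ⟨B, hB, h⟩ := hb ψ hψ hc
    refine exists_succ (f' := fun x => (fderiv ℝ ψ (L x)).comp L) hB h (fun x _ => ?_) fun i => ?_
    · have h1 : HasFDerivAt ψ (fderiv ℝ ψ (L x)) (L x) :=
        (hψ.differentiable (by simp) (L x)).hasFDerivAt
      exact (h1.comp x L.hasFDerivAt).hasFDerivWithinAt
    · exact ih (ψ := fun y => fderiv ℝ ψ y (L (dir i)))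
        ((hψ.fderiv_right (m := ∞) (by simp)).clm_apply contDiff_const)
        (hc.fderiv_apply ℝ (L (dir i)))

end BoundedDerivs

end BoundedDerivs

/-! ### Weak derivatives of functions with continuous derivatives -/

section WeakDeriv

variable {d : ℕ} {Q : Set (SpaceTime d)}

theorem continuous_mul_of_tsupport_subset {V : Type*} [TopologicalSpace V] {Q : Set V}
    (hQ : IsOpen Q) {u ζ : V → ℝ} (hu : ContinuousOn u Q) (hζ : Continuous ζ)
    (hs : tsupport ζ ⊆ Q) : Continuous fun z => u z * ζ z := by
  rw [continuous_iff_continuousAt]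
  intro z
  by_cases hz : z ∈ Q
  · exact (hu.continuousAt (hQ.mem_nhds hz)).mul hζ.continuousAt
  · have : z ∉ tsupport ζ := fun h => hz (hs h)
    rw [notMem_tsupport_iff_eventuallyEq] at this
    refine (continuousAt_const (y := (0 : ℝ))).congr ?_
    filter_upwards [this] with y hy
    simp [hy]

theorem setIntegral_mul_of_tsupport_subset {u ζ : SpaceTime d → ℝ} (hs : tsupport ζ ⊆ Q) :
    ∫ z in Q, u z * ζ z = ∫ z, u z * ζ z :=
  setIntegral_eq_integral_of_forall_compl_eq_zero fun z hz => by
    rw [image_eq_zero_of_notMem_tsupport fun h => hz (hs h), mul_zero]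

theorem integrable_mul_of_tsupport_subset (hQ : IsOpen Q) {u ζ : SpaceTime d → ℝ}
    (hu : ContinuousOn u Q) (hζ : Continuous ζ) (hc : HasCompactSupport ζ)
    (hs : tsupport ζ ⊆ Q) : Integrable fun z => u z * ζ z :=
  (continuous_mul_of_tsupport_subset hQ hu hζ hs).integrable_of_hasCompactSupport hc.mul_left

theorem isWeakDeriv_zero (hQ : IsOpen Q) {u : SpaceTime d → ℝ} (hu : ContinuousOn u Q)
    (κ : Fin 0 → Fin (d + 1)) : IsWeakDeriv Q κ u u := by
  refine ⟨hu.locallyIntegrableOn hQ.measurableSet, hu.locallyIntegrableOn hQ.measurableSet,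
    fun η _ _ _ => ?_⟩
  simp

/-- Integration by parts: a weak derivative of the classical partial derivative `∂_{κ 0} u` is a weak
derivative of `u`. -/
theorem IsWeakDeriv.of_tail (hQ : IsOpen Q) {n : ℕ} {κ : Fin (n + 1) → Fin (d + 1)}
    {u v : SpaceTime d → ℝ} {u' : SpaceTime d → SpaceTime d →L[ℝ] ℝ}
    (hu' : ∀ z ∈ Q, HasFDerivAt u (u' z) z)
    (hc : ContinuousOn (fun z => u' z (coordDir d (κ 0))) Q)
    (hv : IsWeakDeriv Q (Fin.tail κ) (fun z => u' z (coordDir d (κ 0))) v) :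
    IsWeakDeriv Q κ u v := by
  have hu : ContinuousOn u Q := fun z hz => (hu' z hz).continuousAt.continuousWithinAt
  refine ⟨hu.locallyIntegrableOn hQ.measurableSet, hv.2.1, fun η hη hηc hηs => ?_⟩
  have h := hv.2.2 η hη hηc hηs
  set w : Fin n → SpaceTime d := fun i => coordDir d (Fin.tail κ i) with hw
  set ζ : SpaceTime d → ℝ := fun z => iteratedFDeriv ℝ n η z w with hζ
  have hζd : ContDiff ℝ ∞ ζ := by
    have : ContDiff ℝ ∞ (iteratedFDeriv ℝ n η) := hη.iteratedFDeriv_right (by exact_mod_cast le_top)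
    exact (ContinuousMultilinearMap.apply ℝ (fun _ : Fin n => SpaceTime d) ℝ w).contDiff.comp this
  have hsub : tsupport ζ ⊆ tsupport η := by
    refine (closure_mono ?_).trans (tsupport_iteratedFDeriv_subset (𝕜 := ℝ) (f := η) n)
    intro z hz hz'
    exact hz (by simp [hζ, hz'])
  have hζc : HasCompactSupport ζ := hηc.mono' (subset_tsupport _ |>.trans hsub)
  have hζs := hsub.trans hηs
  -- The direction `κ 0` is the outermost derivative of the test function, so a single integration
  -- by parts moves it onto `u`.
  have hder : ∀ z, iteratedFDeriv ℝ (n + 1) η z (fun i => coordDir d (κ i)) =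
      fderiv ℝ ζ z (coordDir d (κ 0)) := fun z => by
    rw [iteratedFDeriv_succ_apply_left]
    have hdiff : DifferentiableAt ℝ (iteratedFDeriv ℝ n η) z :=
      (hη.differentiable_iteratedFDeriv (by exact_mod_cast ENat.natCast_lt_top n)) z
    have := ((ContinuousMultilinearMap.apply ℝ (fun _ : Fin n => SpaceTime d) ℝ
      w).hasFDerivAt.comp z hdiff.hasFDerivAt).fderiv
    have h2 : fderiv ℝ ζ z = _ := this
    rw [h2]
    rfl
  have hfs : tsupport (fun z => fderiv ℝ ζ z (coordDir d (κ 0))) ⊆ Q :=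
    (tsupport_fderiv_apply_subset ℝ _).trans hζs
  have hfc : Continuous fun z => fderiv ℝ ζ z (coordDir d (κ 0)) :=
    (hζd.continuous_fderiv (by simp)).clm_apply continuous_const
  simp_rw [hder]
  rw [setIntegral_mul_of_tsupport_subset hfs]
  have : (volume : Measure (SpaceTime d)).IsAddHaarMeasure :=
    Measure.prod.instIsAddHaarMeasure volume volume
  have hparts := integral_bilinear_hasFDerivAt_right_eq_neg_left_of_integrable
    (μ := (volume : Measure (SpaceTime d)))
    (f := u) (f' := u') (g := ζ) (g' := fderiv ℝ ζ) (v := coordDir d (κ 0))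
    (B := ContinuousLinearMap.mul ℝ ℝ)
    (integrable_mul_of_tsupport_subset hQ hc hζd.continuous hζc hζs)
    (integrable_mul_of_tsupport_subset hQ hu hfc (hζc.fderiv_apply ℝ _) hfs)
    (integrable_mul_of_tsupport_subset hQ hu hζd.continuous hζc hζs)
    (fun z hz => hu' z (hζs hz))
    (fun z _ => (hζd.differentiable (by simp) z).hasFDerivAt)
  simp only [ContinuousLinearMap.mul_apply'] at hparts
  rw [setIntegral_mul_of_tsupport_subset hζs] at h
  rw [hparts, h, pow_succ]
  ring

/-- The classical iterated derivative is the weak one: the directions are peeled off one at a time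
by `IsWeakDeriv.of_tail`. -/
theorem BoundedDerivs.exists_isWeakDeriv (hQ : IsOpen Q) {E : ℝ} {n k : ℕ} {u : SpaceTime d → ℝ}
    (hu : BoundedDerivs (coordDir d) Q E k u) (hn : n ≤ k) (κ : Fin n → Fin (d + 1)) :
    ∃ v, IsWeakDeriv Q κ u v ∧ ∀ z ∈ Q, |v z| ≤ E := by
  induction n generalizing k u with
  | zero => exact ⟨u, isWeakDeriv_zero hQ hu.continuousOn κ, hu.abs_le⟩
  | succ n ih =>
    obtain ⟨k, rfl⟩ : ∃ j, k = j + 1 := ⟨k - 1, by omega⟩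
    obtain ⟨_, u', hu', hi⟩ := hu
    obtain ⟨v, hv, hb⟩ := ih (hi (κ 0)) (by omega) (Fin.tail κ)
    exact ⟨v, IsWeakDeriv.of_tail hQ (fun z hz => (hu' z hz).hasFDerivAt (hQ.mem_nhds hz))
      (hi (κ 0)).continuousOn hv, hb⟩

/-- Classical bounds on the derivatives control the Sobolev norm. -/
theorem BoundedDerivs.sobolevNorm_le (hQ : IsOpen Q) {E : ℝ} {k : ℕ} {u : SpaceTime d → ℝ}
    (hu : BoundedDerivs (coordDir d) Q E k u) : sobolevNorm k Q u ≤ ENNReal.ofReal E := by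
  refine iSup_le fun n => iSup_le fun hn => iSup_le fun κ => ?_
  obtain ⟨v, hv, hb⟩ := hu.exists_isWeakDeriv hQ hn κ
  refine (iInf₂_le v hv).trans ?_
  have : ∀ᵐ z ∂(volume.restrict Q), ‖v z‖ ≤ E :=
    (ae_restrict_iff' hQ.measurableSet).2 (Filter.Eventually.of_forall fun z hz => hb z hz)
  simpa using eLpNorm_le_of_ae_bound (p := ∞) this

theorem IsWeakDeriv.integrable_mul {n : ℕ} {κ : Fin n → Fin (d + 1)} {u v η : SpaceTime d → ℝ}
    (hv : IsWeakDeriv Q κ u v) (hη : Continuous η) (hc : HasCompactSupport η)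
    (hs : tsupport η ⊆ Q) : Integrable fun z => v z * η z := by
  have h1 : IntegrableOn v (tsupport η) := hv.2.1.integrableOn_compact_subset hs hc.isCompact
  have h2 : IntegrableOn (fun z => v z * η z) (tsupport η) :=
    h1.mul_continuousOn hη.continuousOn hc.isCompact
  refine (integrableOn_iff_integrable_of_support_subset fun z hz => ?_).1 h2
  by_contra h
  exact hz (by simp [image_eq_zero_of_notMem_tsupport h])

/-- Weak derivatives are unique up to null sets. -/
theorem IsWeakDeriv.ae_eq (hQ : IsOpen Q) {n : ℕ} {κ : Fin n → Fin (d + 1)}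
    {u v w : SpaceTime d → ℝ} (hv : IsWeakDeriv Q κ u v) (hw : IsWeakDeriv Q κ u w) :
    v =ᵐ[volume.restrict Q] w := by
  have key : ∀ᵐ z ∂(volume : Measure (SpaceTime d)), z ∈ Q → (v - w) z = 0 := by
    -- The fundamental lemma of the calculus of variations: `v` and `w` have the same integrals
    -- against all test functions.
    refine hQ.ae_eq_zero_of_integral_contDiff_smul_eq_zero (hv.2.1.sub hw.2.1)
      fun η hη hc hs => ?_
    have h1 := hv.2.2 η hη hc hs
    rw [hw.2.2 η hη hc hs, setIntegral_mul_of_tsupport_subset hs,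
      setIntegral_mul_of_tsupport_subset hs] at h1
    have h2 := mul_left_cancel₀ (pow_ne_zero n (by norm_num : (-1 : ℝ) ≠ 0)) h1
    have h3 : ∀ z, η z • (v - w) z = v z * η z - w z * η z := fun z => by
      simp only [smul_eq_mul, Pi.sub_apply]; ring
    simp_rw [h3]
    rw [integral_sub (hv.integrable_mul hη.continuous hc hs)
      (hw.integrable_mul hη.continuous hc hs), h2, sub_self]
  rw [Filter.EventuallyEq, ae_restrict_iff' hQ.measurableSet]
  filter_upwards [key] with z hz hzQ
  simpa [sub_eq_zero] using hz hzQ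

/-- A continuous weak derivative is bounded pointwise by the Sobolev norm. -/
theorem IsWeakDeriv.abs_le (hQ : IsOpen Q) {n k : ℕ} (hn : n ≤ k) {κ : Fin n → Fin (d + 1)}
    {u v : SpaceTime d → ℝ} (hv : IsWeakDeriv Q κ u v) (hc : ContinuousOn v Q) {M : ℝ}
    (hM : 0 ≤ M) (hu : sobolevNorm k Q u ≤ ENNReal.ofReal M) : ∀ z ∈ Q, |v z| ≤ M := by
  have h1 : eLpNorm v ∞ (volume.restrict Q) ≤ ENNReal.ofReal M := by
    refine le_trans ?_ (le_trans (le_iSup₂_of_le n hn (le_iSup_of_le κ le_rfl)) hu)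
    exact le_iInf₂ fun w hw => (eLpNorm_congr_ae (hv.ae_eq hQ hw)).le
  have h2 : ∀ᵐ z ∂(volume : Measure (SpaceTime d)), z ∈ Q → |v z| ≤ M := by
    rw [← ae_restrict_iff' hQ.measurableSet]
    rw [eLpNorm_exponent_top] at h1
    filter_upwards [ae_le_eLpNormEssSup (f := v) (μ := volume.restrict Q)] with z hz
    have := hz.trans h1
    rwa [← ofReal_norm, ENNReal.ofReal_le_ofReal_iff hM] at this
  -- By continuity the set where the bound fails is open. It is also null, hence empty.
  have hopen : IsOpen (Q ∩ (fun z => |v z|) ⁻¹' Ioi M) :=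
    hc.abs.isOpen_inter_preimage hQ isOpen_Ioi
  have hnull : volume (Q ∩ (fun z => |v z|) ⁻¹' Ioi M) = 0 := by
    rw [ae_iff] at h2
    refine measure_mono_null (fun z hz => ?_) h2
    simpa using hz
  have hempty := (hopen.measure_eq_zero_iff volume).1 hnull
  intro z hz
  by_contra h
  have : z ∈ Q ∩ (fun z => |v z|) ⁻¹' Ioi M := ⟨hz, not_le.1 h⟩
  rw [hempty] at this
  exact this

/-- The hypothesis `hb` is phrased with weak derivatives because it then passes to each partial
derivative of `f`: a weak derivative of `∂_i f` is one of `f` with `i` prepended. Bounds on `Q`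
reach `S` by density and continuity, and unique differentiability makes `fderivWithin` regular up to
the boundary. -/
theorem boundedDerivs_of_forall_isWeakDeriv {S : Set (SpaceTime d)} (hQ : IsOpen Q) (hQS : Q ⊆ S)
    (hSQ : S ⊆ closure Q) (hS : UniqueDiffOn ℝ S) {M : ℝ} {m : ℕ} {f : SpaceTime d → ℝ}
    (hf : ContDiffOn ℝ m f S)
    (hb : ∀ n ≤ m, ∀ (κ : Fin n → Fin (d + 1)) (v : SpaceTime d → ℝ), ContinuousOn v Q →
      IsWeakDeriv Q κ f v → ∀ z ∈ Q, |v z| ≤ M) :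
    BoundedDerivs (coordDir d) S M m f := by
  have h0 : ∀ z ∈ S, |f z| ≤ M := by
    have hQb := hb 0 (Nat.zero_le m) Fin.elim0 f (hf.continuousOn.mono hQS)
      (isWeakDeriv_zero hQ (hf.continuousOn.mono hQS) _)
    intro z hz
    have hcl : z ∈ closure Q := hSQ hz
    have hcw : ContinuousWithinAt (fun y => |f y|) Q z :=
      ((hf.continuousOn z hz).mono hQS).abs
    have := hcw.mem_closure hcl (t := Iic M) (fun y hy => hQb y hy)
    simpa using this
  induction m generalizing f with
  | zero => exact ⟨hf.continuousOn, h0⟩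
  | succ m ih =>
    have hd : ∀ z ∈ S, HasFDerivWithinAt f (fderivWithin ℝ f S z) S z := fun z hz =>
      ((hf.differentiableOn (by simp)) z hz).hasFDerivWithinAt
    refine ⟨h0, fderivWithin ℝ f S, hd, fun i => ?_⟩
    have hci : ContDiffOn ℝ m (fun z => fderivWithin ℝ f S z (coordDir d i)) S :=
      (hf.fderivWithin hS (by simp)).clm_apply contDiffOn_const
    have hbi : ∀ n ≤ m, ∀ (κ : Fin n → Fin (d + 1)) (v : SpaceTime d → ℝ), ContinuousOn v Q →
        IsWeakDeriv Q κ (fun z => fderivWithin ℝ f S z (coordDir d i)) v →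
        ∀ z ∈ Q, |v z| ≤ M := by
      intro n hn κ v hv hw
      refine hb (n + 1) (by omega) (Fin.cons i κ) v hv ?_
      refine IsWeakDeriv.of_tail (u' := fderivWithin ℝ f S) hQ (fun z hz => ?_) ?_ ?_
      · exact (hd z (hQS hz)).hasFDerivAt (Filter.mem_of_superset (hQ.mem_nhds hz) hQS)
      · simpa using hci.continuousOn.mono hQS
      · simpa using hw
    refine ih hci hbi ?_
    have hQb := hbi 0 (Nat.zero_le m) Fin.elim0 _ (hci.continuousOn.mono hQS)
      (isWeakDeriv_zero hQ (hci.continuousOn.mono hQS) _)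
    intro z hz
    have hcw : ContinuousWithinAt (fun y => |fderivWithin ℝ f S y (coordDir d i)|) Q z :=
      ((hci.continuousOn z hz).mono hQS).abs
    have := hcw.mem_closure (hSQ hz) (t := Iic M) (fun y hy => hQb y hy)
    simpa using this

theorem boundedDerivs_of_sobolevNorm_le {S : Set (SpaceTime d)} (hQ : IsOpen Q) (hQS : Q ⊆ S)
    (hSQ : S ⊆ closure Q) (hS : UniqueDiffOn ℝ S) {M : ℝ} (hM : 0 ≤ M) {m : ℕ}
    {f : SpaceTime d → ℝ} (hf : ContDiffOn ℝ m f S)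
    (hn : sobolevNorm m Q f ≤ ENNReal.ofReal M) : BoundedDerivs (coordDir d) S M m f :=
  boundedDerivs_of_forall_isWeakDeriv hQ hQS hSQ hS hf
    fun _ hnm _ _ hv hw => hw.abs_le hQ hnm hv hM hn

theorem sobolevNorm_mono {k m : ℕ} (h : k ≤ m) (u : SpaceTime d → ℝ) :
    sobolevNorm k Q u ≤ sobolevNorm m Q u :=
  iSup_le fun n => iSup_le fun hn => le_iSup₂_of_le n (hn.trans h) le_rfl

end WeakDeriv

/-! ### Extension by weighted reflections -/

/-- Coefficients that extract the `a`-th coefficient of a polynomial from its values at the nodes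
`x b`. -/
theorem exists_interpolation_coeffs {m : ℕ} {x : Fin (m + 1) → ℝ} (hx : Function.Injective x)
    (a : ℕ) : ∃ c : Fin (m + 1) → ℝ, ∀ j ≤ m, ∑ b, c b * x b ^ j = if j = a then 1 else 0 := by
  refine ⟨fun b => (Lagrange.basis Finset.univ x b).coeff a, fun j hj => ?_⟩
  have hdeg : (Polynomial.X ^ j : Polynomial ℝ).degree < (Finset.univ : Finset (Fin (m + 1))).card := by
    rw [Polynomial.degree_X_pow, Finset.card_univ, Fintype.card_fin]
    exact_mod_cast Nat.lt_succ_of_le hj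
  -- Lagrange interpolation at `m + 1` nodes reproduces `X ^ j`. Comparing coefficients of `X ^ a`
  -- gives the claim.
  have h := Lagrange.eq_interpolate hx.injOn hdeg
  have h2 := congrArg (fun p : Polynomial ℝ => p.coeff a) h
  simp only [Lagrange.interpolate_apply, Polynomial.finsetSum_coeff, Polynomial.coeff_C_mul,
    Polynomial.coeff_X_pow, Polynomial.eval_pow, Polynomial.eval_X] at h2
  rw [show (if j = a then (1 : ℝ) else 0) = if a = j then 1 else 0 by simp [eq_comm], h2]
  exact Finset.sum_congr rfl fun b _ => mul_comm _ _

section Reflect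

variable {V : Type*} [NormedAddCommGroup V] [NormedSpace ℝ V] {ι J : Type*} [Fintype J]

/-- The extension of `a • f` from `{ρ ≤ 0}` across `{ρ = 0}` by a weighted sum of values of `f` at
points reflected in the direction `e`. -/
noncomputable def reflectExtend (ρ : V → ℝ) (e : V) (lam c : J → ℝ) (a : ℝ) (f : V → ℝ) (x : V) : ℝ :=
  if ρ x ≤ 0 then a * f x else ∑ j, c j * f (x - (lam j * ρ x) • e)

variable {dir : ι → V} {S P : Set V} {A : ℝ} {ρ : V → ℝ} {ρ' : V → V →L[ℝ] ℝ} {e : V}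
  {lam : J → ℝ}

theorem reflectExtend_of_nonneg {c : J → ℝ} {a : ℝ} {f : V → ℝ} (hc : ∑ j, c j = a) {x : V}
    (hx : 0 ≤ ρ x) : reflectExtend ρ e lam c a f x = ∑ j, c j * f (x - (lam j * ρ x) • e) := by
  unfold reflectExtend
  split_ifs with h
  · have : ρ x = 0 := le_antisymm h hx
    simp [this, ← Finset.sum_mul, hc]
  · rfl

/-- The sets `ρ ≤ 0` and `0 ≤ ρ` are closed and cover `P`. On their intersection the two formulas
agree because the weights sum to `a`. -/
theorem continuousOn_reflectExtend {c : J → ℝ} {a : ℝ} {f : V → ℝ} (hc : ∑ j, c j = a)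
    (hρ : Continuous ρ) (hneg : ∀ x ∈ P, ρ x ≤ 0 → x ∈ S)
    (hpos : ∀ x ∈ P, 0 ≤ ρ x → ∀ j, x - (lam j * ρ x) • e ∈ S) (hf : ContinuousOn f S) :
    ContinuousOn (reflectExtend ρ e lam c a f) P := by
  intro x hx
  have hP : P = (P ∩ {x | ρ x ≤ 0}) ∪ (P ∩ {x | 0 ≤ ρ x}) := by
    rw [← inter_union_distrib_left]
    exact (inter_eq_left.2 fun y _ => le_total (ρ y) 0).symm
  have hcl₁ : IsClosed {x | ρ x ≤ 0} := isClosed_le hρ continuous_const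
  have hcl₂ : IsClosed {x | 0 ≤ ρ x} := isClosed_le continuous_const hρ
  rw [hP]
  refine ContinuousWithinAt.union ?_ ?_
  · by_cases h : ρ x ≤ 0
    · have h1 : ContinuousWithinAt (fun y => a * f y) (P ∩ {x | ρ x ≤ 0}) x :=
        continuousWithinAt_const.mul ((hf x (hneg x hx h)).mono fun y hy => hneg y hy.1 hy.2)
      exact h1.congr (fun y hy => if_pos hy.2) (if_pos h)
    · exact continuousWithinAt_of_notMem_closure fun hmem =>
        h (closure_minimal inter_subset_right hcl₁ hmem)
  · by_cases h : 0 ≤ ρ x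
    · have h1 : ContinuousWithinAt (fun y => ∑ j, c j * f (y - (lam j * ρ y) • e))
          (P ∩ {x | 0 ≤ ρ x}) x := by
        refine tendsto_finsetSum _ fun j _ => ?_
        refine Filter.Tendsto.const_mul _ ?_
        have hτ : ContinuousWithinAt (fun y => y - (lam j * ρ y) • e) (P ∩ {x | 0 ≤ ρ x}) x := by
          fun_prop
        exact ContinuousWithinAt.comp (t := S) (hf _ (hpos x hx h j)) hτ
          fun y hy => hpos y hy.1 hy.2 j
      exact h1.congr (fun y hy => reflectExtend_of_nonneg hc hy.2) (reflectExtend_of_nonneg hc h)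
    · exact continuousWithinAt_of_notMem_closure fun hmem =>
        h (closure_minimal inter_subset_right hcl₂ hmem)

/-- Each formula is differentiable on its closed piece. Where `ρ = 0`, the reflected sum has the
derivative `a • f'` minus a multiple of `∑ j, c j * lam j`, so the vanishing first moment makes the
two derivatives coincide. -/
theorem hasFDerivWithinAt_reflectExtend {c : J → ℝ} {a : ℝ} {f : V → ℝ} {f' : V → V →L[ℝ] ℝ}
    (hc : ∑ j, c j = a) (hc₁ : ∑ j, c j * lam j = 0)
    (hρ : ∀ x, HasFDerivAt ρ (ρ' x) x) (hneg : ∀ x ∈ P, ρ x ≤ 0 → x ∈ S)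
    (hpos : ∀ x ∈ P, 0 ≤ ρ x → ∀ j, x - (lam j * ρ x) • e ∈ S)
    (hf : ∀ x ∈ S, HasFDerivWithinAt f (f' x) S x) {x : V} (hx : x ∈ P) :
    HasFDerivWithinAt (reflectExtend ρ e lam c a f)
      (if ρ x ≤ 0 then a • f' x else ∑ j, c j • (f' (x - (lam j * ρ x) • e)).comp
        (ContinuousLinearMap.id ℝ V - (lam j • ρ' x).smulRight e)) P x := by
  have hρc : Continuous ρ := continuous_iff_continuousAt.2 fun x => (hρ x).continuousAt
  have hP : P = (P ∩ {x | ρ x ≤ 0}) ∪ (P ∩ {x | 0 ≤ ρ x}) := by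
    rw [← inter_union_distrib_left]
    exact (inter_eq_left.2 fun y _ => le_total (ρ y) 0).symm
  have hcl₁ : IsClosed {x | ρ x ≤ 0} := isClosed_le hρc continuous_const
  have hcl₂ : IsClosed {x | 0 ≤ ρ x} := isClosed_le continuous_const hρc
  rw [hP]
  refine HasFDerivWithinAt.union ?_ ?_
  · by_cases h : ρ x ≤ 0
    · rw [if_pos h]
      have h1 : HasFDerivWithinAt (fun y => a * f y) (a • f' x) (P ∩ {x | ρ x ≤ 0}) x :=
        ((hf x (hneg x hx h)).mono fun y hy => hneg y hy.1 hy.2).const_mul a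
      exact h1.congr (fun y hy => if_pos hy.2) (if_pos h)
    · exact HasFDerivWithinAt.of_notMem_closure fun hmem =>
        h (closure_minimal inter_subset_right hcl₁ hmem)
  · by_cases h : 0 ≤ ρ x
    · have h1 : HasFDerivWithinAt (fun y => ∑ j, c j * f (y - (lam j * ρ y) • e))
          (∑ j, c j • (f' (x - (lam j * ρ x) • e)).comp
            (ContinuousLinearMap.id ℝ V - (lam j • ρ' x).smulRight e)) (P ∩ {x | 0 ≤ ρ x}) x := by
        refine HasFDerivWithinAt.fun_sum fun j _ => ?_
        refine HasFDerivWithinAt.const_mul ?_ (c j)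
        have hτ : HasFDerivWithinAt (fun y => y - (lam j * ρ y) • e)
            (ContinuousLinearMap.id ℝ V - (lam j • ρ' x).smulRight e) (P ∩ {x | 0 ≤ ρ x}) x :=
          (hasFDerivWithinAt_id x _).sub
            (((hρ x).hasFDerivWithinAt.const_mul (lam j)).smul_const e)
        exact HasFDerivWithinAt.comp (t := S) x (hf _ (hpos x hx h j)) hτ
          fun y hy => hpos y hy.1 hy.2 j
      have h2 : (if ρ x ≤ 0 then a • f' x else ∑ j, c j • (f' (x - (lam j * ρ x) • e)).comp
          (ContinuousLinearMap.id ℝ V - (lam j • ρ' x).smulRight e)) =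
          ∑ j, c j • (f' (x - (lam j * ρ x) • e)).comp
            (ContinuousLinearMap.id ℝ V - (lam j • ρ' x).smulRight e) := by
        split_ifs with h0
        · have hz : ρ x = 0 := le_antisymm h0 h
          ext v
          simp [hz, ← hc, Finset.sum_mul, mul_sub,
            Finset.sum_sub_distrib]
          rw [show ∑ j, c j * (lam j * ρ' x v * f' x e) =
            (∑ j, c j * lam j) * (ρ' x v * f' x e) by
              rw [Finset.sum_mul]; exact Finset.sum_congr rfl fun j _ => by ring, hc₁, zero_mul, sub_zero]
        · rfl
      rw [h2]
      exact h1.congr (fun y hy => reflectExtend_of_nonneg hc hy.2) (reflectExtend_of_nonneg hc h)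
    · exact HasFDerivWithinAt.of_notMem_closure fun hmem =>
        h (closure_minimal inter_subset_right hcl₂ hmem)

theorem abs_reflectExtend_le {c : J → ℝ} {a M : ℝ} {f : V → ℝ} (hM : 0 ≤ M)
    (hneg : ∀ x ∈ P, ρ x ≤ 0 → x ∈ S)
    (hpos : ∀ x ∈ P, 0 ≤ ρ x → ∀ j, x - (lam j * ρ x) • e ∈ S) (hf : ∀ x ∈ S, |f x| ≤ M) :
    ∀ x ∈ P, |reflectExtend ρ e lam c a f x| ≤ (|a| + ∑ j, |c j|) * M := by
  intro x hx
  have hs : 0 ≤ ∑ j, |c j| := Finset.sum_nonneg fun j _ => abs_nonneg _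
  unfold reflectExtend
  split_ifs with h
  · rw [abs_mul]
    have := mul_le_mul_of_nonneg_left (hf x (hneg x hx h)) (abs_nonneg a)
    have := mul_nonneg hs hM
    linarith
  · refine (Finset.abs_sum_le_sum_abs _ _).trans ?_
    have h1 : ∑ j, |c j * f (x - (lam j * ρ x) • e)| ≤ ∑ j, |c j| * M :=
      Finset.sum_le_sum fun j _ => by
        rw [abs_mul]
        exact mul_le_mul_of_nonneg_left (hf _ (hpos x hx (not_le.1 h).le j)) (abs_nonneg _)
    rw [← Finset.sum_mul] at h1
    have := mul_nonneg (abs_nonneg a) hM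
    linarith

/-- The extension by reflections preserves bounds on derivatives up to order `m`, if the weights
satisfy the moment conditions up to order `m`. -/
theorem BoundedDerivs.exists_reflectExtend [Fintype ι] {w : ι → ℝ} (he : e = ∑ l, w l • dir l)
    (hρ : ∀ x, HasFDerivAt ρ (ρ' x) x) (hneg : ∀ x ∈ P, ρ x ≤ 0 → x ∈ S)
    (hpos : ∀ x ∈ P, 0 ≤ ρ x → ∀ j, x - (lam j * ρ x) • e ∈ S) (hA : 0 ≤ A) (m : ℕ)
    (hρb : ∀ i, BoundedDerivs dir P A m (fun x => ρ' x (dir i))) (c : J → ℝ) (a : ℝ)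
    (hc : ∀ i ≤ m, ∑ j, c j * lam j ^ i = if i = 0 then a else 0) :
    ∃ K, 0 ≤ K ∧ ∀ (f : V → ℝ) (M : ℝ), 0 ≤ M → BoundedDerivs dir S M m f →
      BoundedDerivs dir P (K * M) m (reflectExtend ρ e lam c a f) := by
  have hρc : Continuous ρ := continuous_iff_continuousAt.2 fun x => (hρ x).continuousAt
  have hK₀ : ∀ (c : J → ℝ) (a : ℝ), 0 ≤ |a| + ∑ j, |c j| := fun c a =>
    add_nonneg (abs_nonneg a) (Finset.sum_nonneg fun j _ => abs_nonneg _)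
  induction m generalizing c a with
  | zero =>
    have hc0 : ∑ j, c j = a := by simpa using hc 0 le_rfl
    exact ⟨_, hK₀ c a, fun f M hM hf => ⟨continuousOn_reflectExtend hc0 hρc hneg hpos hf.1,
      abs_reflectExtend_le hM hneg hpos hf.2⟩⟩
  | succ m ih =>
    have hc0 : ∑ j, c j = a := by simpa using hc 0 (Nat.zero_le _)
    have hc1 : ∑ j, c j * lam j = 0 := by simpa using hc 1 (by omega)
    obtain ⟨K₁, hK₁, h₁⟩ := ih (fun i => (hρb i).pred) c a fun i hi => hc i (by omega)
    -- For `0 < ρ`, the `i`-th partial derivative of the extension is the extension of `∂_i f` with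
    -- weights `c`, minus `∂_i ρ` times the extension of `∂_e f` with weights `c j * lam j` and `a =
    -- 0`. The moments of the new weights are the old ones shifted by one, which costs exactly one
    -- order.
    obtain ⟨K₂, hK₂, h₂⟩ := ih (fun i => (hρb i).pred) (fun j => c j * lam j) 0 fun i hi => by
      have := hc (i + 1) (by omega)
      simp only [Nat.succ_ne_zero, if_false] at this
      rw [ite_self, ← this]
      exact Finset.sum_congr rfl fun j _ => by ring
    set K := K₁ + 2 ^ m * (A * ∑ l, |w l| * K₂) with hK
    have hsum : 0 ≤ ∑ l, |w l| * K₂ :=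
      Finset.sum_nonneg fun l _ => mul_nonneg (abs_nonneg _) hK₂
    have hK0 : 0 ≤ K := by positivity
    refine ⟨K + (|a| + ∑ j, |c j|), add_nonneg hK0 (hK₀ c a), fun f M hM hf => ?_⟩
    obtain ⟨f0, f', hf', fi⟩ := hf
    refine ⟨fun x hx => (abs_reflectExtend_le hM hneg hpos f0 x hx).trans ?_, _,
      fun x hx => hasFDerivWithinAt_reflectExtend hc0 hc1 hρ hneg hpos hf' hx, fun i => ?_⟩
    · exact mul_le_mul_of_nonneg_right (by linarith) hM
    -- Only derivatives along the `dir l` are controlled, so `∂_e f` is expanded in them.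
    · have hsumb := BoundedDerivs.sum Finset.univ fun l _ =>
        (h₂ (fun x => f' x (dir l)) M hM (fi l)).const_mul (w l)
      have hs' : 0 ≤ ∑ l, |w l| * (K₂ * M) :=
        Finset.sum_nonneg fun l _ => mul_nonneg (abs_nonneg _) (mul_nonneg hK₂ hM)
      have hb := (h₁ (fun x => f' x (dir i)) M hM (fi i)).sub
        (BoundedDerivs.mul hA hs' (hρb i).pred hsumb)
      refine (hb.mono_bound ?_).congr fun x _ => ?_
      · have : K₁ * M + 2 ^ m * (A * ∑ l, |w l| * (K₂ * M)) = K * M := by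
          have h3 : ∑ l, |w l| * (K₂ * M) = (∑ l, |w l| * K₂) * M := by
            rw [Finset.sum_mul]
            exact Finset.sum_congr rfl fun l _ => by ring
          rw [hK, h3]
          ring
        rw [this]
        exact mul_le_mul_of_nonneg_right (by linarith [hK₀ c a]) hM
      · simp only [reflectExtend]
        split_ifs with h
        · simp
        · have he' : ∀ y, f' y e = ∑ l, w l * f' y (dir l) := fun y => by simp [he]
          simp only [sum_apply, smul_apply,
            ContinuousLinearMap.comp_apply, sub_apply,
            ContinuousLinearMap.id_apply, ContinuousLinearMap.smulRight_apply, map_sub, map_smul,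
            smul_eq_mul, he', mul_sub, Finset.sum_sub_distrib, Finset.mul_sum]
          congr 1
          rw [Finset.sum_comm]
          exact Finset.sum_congr rfl fun l _ => Finset.sum_congr rfl fun j _ => by ring

end Reflect

/-! ### Smooth bounded domains -/

theorem exists_contDiff_partition {E : Type*} [NormedAddCommGroup E] [NormedSpace ℝ E]
    [FiniteDimensional ℝ E] {κ : Type*} [Fintype κ] {s : Set E} (hs : IsClosed s) (U : κ → Set E)
    (ho : ∀ i, IsOpen (U i)) (hb : ∀ i, Bornology.IsBounded (U i)) (hU : s ⊆ ⋃ i, U i) :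
    ∃ χ : κ → E → ℝ, (∀ i, ContDiff ℝ ∞ (χ i)) ∧ (∀ i, HasCompactSupport (χ i)) ∧
      (∀ i, tsupport (χ i) ⊆ U i) ∧ ∀ x ∈ s, ∑ i, χ i x = 1 := by
  obtain ⟨f, hf⟩ := SmoothPartitionOfUnity.exists_isSubordinate (modelWithCornersSelf ℝ E) hs U ho hU
  refine ⟨fun i => f i, fun i => (f i).contMDiff.contDiff, fun i => ?_, hf, fun x hx => ?_⟩
  · exact Metric.isCompact_of_isClosed_isBounded (isClosed_tsupport _) ((hb i).subset (hf i))
  · rw [← f.sum_eq_one hx, finsum_eq_sum_of_fintype]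

/-- The coordinate functionals of space-time. -/
noncomputable def coordFun (d : ℕ) : Fin (d + 1) → SpaceTime d →L[ℝ] ℝ :=
  Fin.cons (ContinuousLinearMap.fst ℝ ℝ (EuclideanSpace ℝ (Fin d)))
    (fun i => (EuclideanSpace.proj i).comp (ContinuousLinearMap.snd ℝ ℝ (EuclideanSpace ℝ (Fin d))))

theorem sum_coordFun_smul_coordDir {d : ℕ} (z : SpaceTime d) :
    ∑ i, coordFun d i z • coordDir d i = z := by
  rw [Fin.sum_univ_succ]
  simp only [coordFun, coordDir, Fin.cons_zero, Fin.cons_succ]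
  refine Prod.ext ?_ ?_
  · simp [Prod.fst_sum]
  · ext j
    simp [Prod.snd_sum, Finset.sum_apply, Pi.single_apply]

section Domain

variable {d : ℕ} {Ω : Set (EuclideanSpace ℝ (Fin d))}

namespace IsSmoothBoundedDomain

/-- A bump function equal to `1` near `x₀` makes the local defining function global with compact
support, hence with bounded derivatives. The vector `e` is normalised to have derivative `1` at
`x₀`; by continuity it remains transversal to the level sets nearby. -/
theorem exists_defining_function (hΩ : IsSmoothBoundedDomain Ω) {x₀ : EuclideanSpace ℝ (Fin d)}
    (hx₀ : x₀ ∈ frontier Ω) :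
    ∃ (ρ : EuclideanSpace ℝ (Fin d) → ℝ) (e : EuclideanSpace ℝ (Fin d)) (r : ℝ), 0 < r ∧
      ContDiff ℝ ∞ ρ ∧ HasCompactSupport ρ ∧ ρ x₀ = 0 ∧
      (∀ x ∈ Metric.ball x₀ r, 1 / 2 ≤ fderiv ℝ ρ x e) ∧
      ∀ x ∈ Metric.ball x₀ r, x ∈ Ω ↔ ρ x < 0 := by
  obtain ⟨U, hU, hxU, ρ₀, hρ₀, hd, hΩU⟩ := hΩ.smooth_boundary x₀ hx₀
  obtain ⟨r₀, hr₀, hr₀U⟩ := Metric.isOpen_iff.1 hU x₀ hxU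
  let b : ContDiffBump x₀ := ⟨r₀ / 4, r₀ / 2, by positivity, by linarith⟩
  have hbU : tsupport b ⊆ U := by
    rw [b.tsupport_eq]
    exact (Metric.closedBall_subset_ball (by change r₀ / 2 < r₀; linarith)).trans hr₀U
  have hρ : ContDiff ℝ ∞ fun x => b x * ρ₀ x := by
    rw [contDiff_iff_contDiffAt]
    intro x
    by_cases hx : x ∈ U
    · exact b.contDiffAt.mul (hρ₀.contDiffAt (hU.mem_nhds hx))
    · have : x ∉ tsupport b := fun h => hx (hbU h)
      rw [notMem_tsupport_iff_eventuallyEq] at this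
      refine (contDiffAt_const (c := (0 : ℝ))).congr_of_eventuallyEq ?_
      filter_upwards [this] with y hy
      simp [hy]
  have heq : ∀ x ∈ Metric.ball x₀ (r₀ / 4), b x * ρ₀ x = ρ₀ x := fun x hx => by
    rw [b.one_of_mem_closedBall (Metric.ball_subset_closedBall hx), one_mul]
  have hiff : ∀ x ∈ Metric.ball x₀ (r₀ / 4), x ∈ Ω ↔ b x * ρ₀ x < 0 := fun x hx => by
    have hxU : x ∈ U := hr₀U (Metric.ball_subset_ball (by linarith) hx)
    rw [heq x hx]
    constructor
    · intro h
      have : x ∈ Ω ∩ U := ⟨h, hxU⟩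
      rw [hΩU] at this
      exact this.2
    · intro h
      have : x ∈ {y ∈ U | ρ₀ y < 0} := ⟨hxU, h⟩
      rw [← hΩU] at this
      exact this.1
  have hfd : fderiv ℝ (fun x => b x * ρ₀ x) x₀ = fderiv ℝ ρ₀ x₀ := by
    refine Filter.EventuallyEq.fderiv_eq ?_
    filter_upwards [Metric.ball_mem_nhds x₀ (by positivity : 0 < r₀ / 4)] with x hx using heq x hx
  obtain ⟨v, hv⟩ : ∃ v, fderiv ℝ ρ₀ x₀ v ≠ 0 := by
    by_contra! h
    exact hd (ContinuousLinearMap.ext h)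
  set e := (fderiv ℝ ρ₀ x₀ v)⁻¹ • v with he
  have he1 : fderiv ℝ (fun x => b x * ρ₀ x) x₀ e = 1 := by
    rw [hfd, he, map_smul, smul_eq_mul, inv_mul_cancel₀ hv]
  have hcont : Continuous fun x => fderiv ℝ (fun x => b x * ρ₀ x) x e :=
    (hρ.continuous_fderiv (by simp)).clm_apply continuous_const
  have hev : ∀ᶠ x in 𝓝 x₀, 1 / 2 < fderiv ℝ (fun x => b x * ρ₀ x) x e :=
    hcont.continuousAt.eventually_const_lt (by simp only [he1]; norm_num)
  obtain ⟨r₁, hr₁, hr₁b⟩ := Metric.eventually_nhds_iff_ball.1 hev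
  have hx₀mem : x₀ ∈ Metric.ball x₀ (r₀ / 4) := Metric.mem_ball_self (by positivity)
  refine ⟨fun x => b x * ρ₀ x, e, min r₁ (r₀ / 4), by positivity, hρ, b.hasCompactSupport.mul_right,
    le_antisymm ?_ ?_, fun x hx => (hr₁b x (Metric.ball_subset_ball (min_le_left _ _) hx)).le,
    fun x hx => hiff x (Metric.ball_subset_ball (min_le_right _ _) hx)⟩
  -- `ρ x₀ ≤ 0` since `x₀` is a limit of points of `Ω`, and `ρ x₀ < 0` would put `x₀` in the open
  -- set `Ω`, which misses its frontier.
  · have hcl : x₀ ∈ closure (Ω ∩ Metric.ball x₀ (r₀ / 4)) := by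
      rw [inter_comm]
      exact Metric.isOpen_ball.inter_closure ⟨hx₀mem, frontier_subset_closure hx₀⟩
    have := closure_minimal (t := {x | b x * ρ₀ x ≤ 0}) (fun x hx => ((hiff x hx.2).1 hx.1).le)
      (isClosed_le hρ.continuous continuous_const) hcl
    exact this
  · by_contra! h
    have : x₀ ∈ Ω := (hiff x₀ hx₀mem).2 h
    rw [hΩ.isOpen.frontier_eq] at hx₀
    exact hx₀.2 this

/-- An interior cone condition. Near a boundary point, `ρ` differs from its linearisation by at most
`c * ‖x - x₀‖`, so the truncated open convex cone `φ (x - x₀) + c * ‖x - x₀‖ < 0` lies in `Ω`. A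
convex set with interior has unique derivatives at each point of its closure. -/
theorem uniqueDiffOn_closure (hΩ : IsSmoothBoundedDomain Ω) : UniqueDiffOn ℝ (closure Ω) := by
  intro x₀ hx₀
  by_cases hx : x₀ ∈ Ω
  · exact (hΩ.isOpen.uniqueDiffWithinAt hx).mono subset_closure
  have hfr : x₀ ∈ frontier Ω := by rw [hΩ.isOpen.frontier_eq]; exact ⟨hx₀, hx⟩
  obtain ⟨ρ, e, r, hr, hρ, -, h0, hd, hiff⟩ := hΩ.exists_defining_function hfr
  have he : 1 / 2 ≤ fderiv ℝ ρ x₀ e := hd x₀ (Metric.mem_ball_self hr)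
  set φ := fderiv ℝ ρ x₀ with hφ
  have hc : 0 < 1 / (4 * (‖e‖ + 1)) := by positivity
  set c := 1 / (4 * (‖e‖ + 1)) with hcdef
  -- Since `φ e ≥ 1 / 2`, this bound places `-e` in the cone, so `x₀` is a limit of the points `x₀ -
  -- t • e` of the cone.
  have hce : c * ‖e‖ ≤ 1 / 4 := by
    rw [hcdef, div_mul_eq_mul_div, div_le_div_iff₀ (by positivity) (by norm_num)]
    linarith
  have hlit : ∀ᶠ x in 𝓝 x₀, ‖ρ x - ρ x₀ - φ (x - x₀)‖ ≤ c * ‖x - x₀‖ :=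
    ((hρ.differentiable (by simp) x₀).hasFDerivAt.isLittleO).def hc
  obtain ⟨δ, hδ, hδb⟩ := Metric.eventually_nhds_iff_ball.1 hlit
  have hmin : 0 < min δ r := lt_min hδ hr
  let s : Set (EuclideanSpace ℝ (Fin d)) :=
    {x | φ (x - x₀) + c * ‖x - x₀‖ < 0} ∩ Metric.ball x₀ (min δ r)
  have hsΩ : s ⊆ Ω := fun x hx => by
    refine (hiff x (Metric.ball_subset_ball (min_le_right _ _) hx.2)).2 ?_
    have h1 := hδb x (Metric.ball_subset_ball (min_le_left _ _) hx.2)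
    rw [h0, sub_zero, Real.norm_eq_abs] at h1
    have h2 := (abs_le.1 h1).2
    have h3 : φ (x - x₀) + c * ‖x - x₀‖ < 0 := hx.1
    linarith
  have hconv : Convex ℝ s := by
    refine Convex.inter ?_ (convex_ball _ _)
    have h1 : ConvexOn ℝ univ fun x => φ (x - x₀) + c * ‖x - x₀‖ := by
      have h2 : ConvexOn ℝ univ fun x => φ x + -φ x₀ :=
        ConvexOn.add_const (φ.toLinearMap.convexOn convex_univ) _
      have h3 : ConvexOn ℝ univ fun x : EuclideanSpace ℝ (Fin d) => ‖x - x₀‖ := by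
        simpa [dist_eq_norm] using convexOn_univ_dist x₀
      exact (h2.add (h3.smul hc.le)).congr fun x _ => by simp [sub_eq_add_neg]
    simpa using h1.convex_lt 0
  have hopen : IsOpen s := by
    refine IsOpen.inter (isOpen_lt ?_ continuous_const) Metric.isOpen_ball
    fun_prop
  have hmem : ∀ t : ℝ, 0 < t → t * ‖e‖ < min δ r → x₀ - t • e ∈ s := fun t ht htb => by
    refine ⟨?_, ?_⟩
    · have : x₀ - t • e - x₀ = -(t • e) := by abel
      simp only [mem_ofPred_eq, this, map_neg, map_smul, norm_neg, norm_smul, Real.norm_eq_abs,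
        abs_of_pos ht, smul_eq_mul]
      nlinarith
    · rw [Metric.mem_ball, dist_eq_norm]
      simpa [norm_smul, abs_of_pos ht] using htb
  have htend : Filter.Tendsto (fun t : ℝ => x₀ - t • e) (𝓝[>] 0) (𝓝 x₀) := by
    have : Continuous fun t : ℝ => x₀ - t • e := by fun_prop
    simpa using (this.tendsto 0).mono_left nhdsWithin_le_nhds
  have hevs : ∀ᶠ t : ℝ in 𝓝[>] 0, x₀ - t • e ∈ s := by
    have h1 : ∀ᶠ t : ℝ in 𝓝[>] 0, t * ‖e‖ < min δ r := by
      have : Continuous fun t : ℝ => t * ‖e‖ := by fun_prop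
      exact ((this.tendsto 0).mono_left nhdsWithin_le_nhds).eventually_lt_const
        (by simpa using hmin)
    filter_upwards [h1, self_mem_nhdsWithin] with t ht ht0 using hmem t ht0 ht
  have hcl : x₀ ∈ closure s := mem_closure_of_tendsto htend hevs
  have hne : (interior s).Nonempty := by
    rw [hopen.interior_eq]
    exact closure_nonempty_iff.1 ⟨x₀, hcl⟩
  exact (uniqueDiffWithinAt_convex hconv hne hcl).mono (hsΩ.trans subset_closure)

/-- Near each point of the closure of `Ω`, functions on `Ω` can be extended across the boundary of
`Ω` with control of the derivatives. -/
theorem exists_local_extension (hΩ : IsSmoothBoundedDomain Ω) (m : ℕ) (I : Set ℝ)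
    {x₀ : EuclideanSpace ℝ (Fin d)} (hx₀ : x₀ ∈ closure Ω) :
    ∃ U : Set (EuclideanSpace ℝ (Fin d)), IsOpen U ∧ x₀ ∈ U ∧ Bornology.IsBounded U ∧
      ∃ K, 0 ≤ K ∧ ∀ (f : SpaceTime d → ℝ) (M : ℝ), 0 ≤ M →
        BoundedDerivs (coordDir d) (I ×ˢ closure Ω) M m f →
        ∃ F : SpaceTime d → ℝ, EqOn F f (I ×ˢ (closure Ω ∩ U)) ∧
          BoundedDerivs (coordDir d) (I ×ˢ U) (K * M) m F := by
  by_cases hx : x₀ ∈ Ω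
  · refine ⟨Ω, hΩ.isOpen, hx, hΩ.isBounded, 1, zero_le_one, fun f M _ hf => ⟨f, fun _ _ => rfl, ?_⟩⟩
    rw [one_mul]
    exact hf.mono_set (prod_mono_right subset_closure)
  have hfr : x₀ ∈ frontier Ω := by rw [hΩ.isOpen.frontier_eq]; exact ⟨hx₀, hx⟩
  obtain ⟨ρ, e, r, hr, hρ, hρc, h0, hd, hiff⟩ := hΩ.exists_defining_function hfr
  -- By the mean value inequality, moving by `-s • e` inside the ball lowers `ρ` by at least `s /
  -- 2`.
  have hlin : ∀ y ∈ Metric.ball x₀ r, ∀ s : ℝ, 0 ≤ s → y - s • e ∈ Metric.ball x₀ r →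
      ρ (y - s • e) ≤ ρ y - s / 2 := by
    intro y hy s hs hys
    have hmem : ∀ t ∈ Icc 0 s, y - t • e ∈ Metric.ball x₀ r := by
      intro t ht
      rcases hs.eq_or_lt with rfl | hs
      · obtain rfl : t = 0 := le_antisymm ht.2 ht.1
        simpa using hy
      have := (convex_ball x₀ r).add_smul_sub_mem hy hys (t := t / s)
        ⟨div_nonneg ht.1 hs.le, (div_le_one hs).2 ht.2⟩
      have h2 : y + (t / s) • (y - s • e - y) = y - t • e := by
        rw [sub_sub_cancel_left, smul_neg, smul_smul, div_mul_cancel₀ _ hs.ne', ← sub_eq_add_neg]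
      rwa [h2] at this
    have hder : ∀ t, HasDerivAt (fun t : ℝ => ρ (y - t • e)) (fderiv ℝ ρ (y - t • e) (-e)) t := by
      intro t
      have h1 : HasDerivAt (fun t : ℝ => y - t • e) (-e) t := by
        simpa using ((hasDerivAt_id t).smul_const e).const_sub y
      exact ((hρ.differentiable (by simp) _).hasFDerivAt).comp_hasDerivAt t h1
    have := (convex_Icc 0 s).image_sub_le_mul_sub_of_deriv_le
      (f := fun t : ℝ => ρ (y - t • e)) (C := -(1 / 2))
      (fun t _ => (hder t).continuousAt.continuousWithinAt)
      (fun t _ => (hder t).differentiableAt.differentiableWithinAt)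
      (fun t ht => by
        rw [(hder t).deriv, map_neg]
        exact neg_le_neg (hd _ (hmem t (interior_subset ht)))) 0 (left_mem_Icc.2 hs) s
      (right_mem_Icc.2 hs) hs
    simp only [zero_smul, sub_zero] at this
    linarith
  -- A smaller ball from which all reflected points stay in the larger one: every factor `lam j`
  -- below is at most `m + 4`, and `ρ x` is small near `x₀`.
  obtain ⟨r', hr', hr'b⟩ : ∃ r' > 0, ∀ x ∈ Metric.ball x₀ r',
      ‖x - x₀‖ + (m + 4 : ℝ) * |ρ x| * ‖e‖ < r := by
    have hcont : Continuous fun x => ‖x - x₀‖ + (m + 4 : ℝ) * |ρ x| * ‖e‖ := by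
      have := hρ.continuous
      fun_prop
    have hev : ∀ᶠ x in 𝓝 x₀, ‖x - x₀‖ + (m + 4 : ℝ) * |ρ x| * ‖e‖ < r :=
      hcont.continuousAt.eventually_lt_const (by simpa [h0] using hr)
    exact Metric.eventually_nhds_iff_ball.1 hev
  have hsub : ∀ x ∈ Metric.ball x₀ r', x ∈ Metric.ball x₀ r := fun x hx => by
    rw [Metric.mem_ball, dist_eq_norm]
    have := hr'b x hx
    have : 0 ≤ (m + 4 : ℝ) * |ρ x| * ‖e‖ := by positivity
    linarith
  have hclos : ∀ x ∈ Metric.ball x₀ r', ρ x ≤ 0 → x ∈ closure Ω := by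
    intro x hx hρx
    rcases hρx.lt_or_eq with h | h
    · exact subset_closure ((hiff x (hsub x hx)).2 h)
    have hcont : Continuous fun t : ℝ => x - t • e := by fun_prop
    have htend : Filter.Tendsto (fun t : ℝ => x - t • e) (𝓝[>] 0) (𝓝 x) := by
      simpa using (hcont.tendsto 0).mono_left nhdsWithin_le_nhds
    have hball : ∀ᶠ t : ℝ in 𝓝[>] 0, x - t • e ∈ Metric.ball x₀ r :=
      htend.eventually (Metric.isOpen_ball.mem_nhds (hsub x hx))
    refine mem_closure_of_tendsto htend ?_
    filter_upwards [hball, self_mem_nhdsWithin] with t ht ht0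
    have ht0' : (0 : ℝ) < t := ht0
    have := hlin x (hsub x hx) t ht0'.le ht
    exact (hiff _ ht).2 (by linarith)
  -- With `lam j ≥ 4`, the reflected point satisfies `ρ ≤ ρ x - 2 * ρ x < 0` whenever `0 < ρ x`, so
  -- it lies in `Ω`.
  let lam : Fin (m + 1) → ℝ := fun j => 4 + (j : ℕ)
  have hlam : Function.Injective lam := fun i j hij => by
    have : ((i : ℕ) : ℝ) = (j : ℕ) := by simpa [lam] using hij
    exact Fin.ext (by exact_mod_cast this)
  -- Extracting the constant coefficient gives zeroth moment `1` and vanishing moments of orders `1`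
  -- to `m`.
  obtain ⟨c, hc⟩ := exists_interpolation_coeffs hlam 0
  obtain ⟨A, hA, hAb⟩ := BoundedDerivs.exists_uniform_bound (dir := coordDir d) (S := univ) (m := m)
    (F := fun i z => fderiv ℝ ρ z.2 (coordDir d i).2) fun i =>
    BoundedDerivs.exists_of_hasCompactSupport_comp (ContinuousLinearMap.snd ℝ ℝ _)
      (ψ := fun y => fderiv ℝ ρ y (coordDir d i).2)
      ((hρ.fderiv_right (m := ∞) (by simp)).clm_apply contDiff_const)
      (hρc.fderiv_apply ℝ _) m
  obtain ⟨K, hK, hKb⟩ := BoundedDerivs.exists_reflectExtend (dir := coordDir d)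
    (S := I ×ˢ closure Ω) (P := I ×ˢ Metric.ball x₀ r') (ρ := fun z => ρ z.2)
    (ρ' := fun z => (fderiv ℝ ρ z.2).comp (ContinuousLinearMap.snd ℝ ℝ _))
    (e := ((0 : ℝ), e)) (lam := lam) (A := A) (sum_coordFun_smul_coordDir _).symm
    (fun z => ((hρ.differentiable (by simp) z.2).hasFDerivAt).comp z hasFDerivAt_snd)
    (fun z hz hz0 => ⟨hz.1, hclos z.2 hz.2 hz0⟩)
    (fun z hz hz0 j => by
      refine ⟨by simpa using hz.1, ?_⟩
      have hz0' : 0 ≤ ρ z.2 := hz0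
      change z.2 - (lam j * ρ z.2) • e ∈ closure Ω
      rcases hz0'.eq_or_lt with h | h
      · rw [← h, mul_zero, zero_smul, sub_zero]
        exact hclos z.2 hz.2 h.symm.le
      · have hl4 : 4 ≤ lam j := by simp [lam]
        have hlm : lam j ≤ m + 4 := by
          have : ((j : ℕ) : ℝ) ≤ m := by exact_mod_cast Nat.lt_succ_iff.1 j.2
          simp only [lam]; linarith
        have hball : z.2 - (lam j * ρ z.2) • e ∈ Metric.ball x₀ r := by
          rw [Metric.mem_ball, dist_eq_norm]
          calc ‖z.2 - (lam j * ρ z.2) • e - x₀‖ = ‖(z.2 - x₀) - (lam j * ρ z.2) • e‖ := by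
                congr 1; abel
            _ ≤ ‖z.2 - x₀‖ + ‖(lam j * ρ z.2) • e‖ := norm_sub_le _ _
            _ = ‖z.2 - x₀‖ + lam j * |ρ z.2| * ‖e‖ := by
                rw [norm_smul, Real.norm_eq_abs, abs_mul, abs_of_nonneg (by linarith : 0 ≤ lam j)]
            _ ≤ ‖z.2 - x₀‖ + (m + 4 : ℝ) * |ρ z.2| * ‖e‖ := by gcongr
            _ < r := hr'b z.2 hz.2
        have := hlin z.2 (hsub z.2 hz.2) (lam j * ρ z.2) (by positivity) hball
        refine subset_closure ((hiff _ hball).2 ?_)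
        nlinarith)
    hA m (fun i => (hAb i).mono_set (subset_univ _)) c 1 hc
  refine ⟨Metric.ball x₀ r', Metric.isOpen_ball, Metric.mem_ball_self hr', Metric.isBounded_ball,
    K, hK, fun f M hM hf => ⟨_, fun z hz => ?_, hKb f M hM hf⟩⟩
  have hz2 : z.2 ∈ closure (Metric.ball x₀ r' ∩ Ω) :=
    Metric.isOpen_ball.inter_closure ⟨hz.2.2, hz.2.1⟩
  have : ρ z.2 ≤ 0 := closure_minimal (t := {x | ρ x ≤ 0})
    (fun x hx => ((hiff x (hsub x hx.1)).1 hx.2).le)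
    (isClosed_le hρ.continuous continuous_const) hz2
  simp [reflectExtend, this]

end IsSmoothBoundedDomain

end Domain

/-! ### Extension from a space-time cylinder -/

section Extension

variable {d : ℕ} {Ω : Set (EuclideanSpace ℝ (Fin d))}

/-- Finitely many local extensions cover the compact closure and are glued by a partition of unity.
On `closure Ω` each local extension agrees with `f` wherever its cutoff is nonzero. -/
theorem IsSmoothBoundedDomain.exists_space_extension (hΩ : IsSmoothBoundedDomain Ω) (m : ℕ)
    (I : Set ℝ) :
    ∃ K, 0 ≤ K ∧ ∀ (f : SpaceTime d → ℝ) (M : ℝ), 0 ≤ M →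
      BoundedDerivs (coordDir d) (I ×ˢ closure Ω) M m f →
      ∃ F : SpaceTime d → ℝ, EqOn F f (I ×ˢ closure Ω) ∧
        BoundedDerivs (coordDir d) (I ×ˢ univ) (K * M) m F := by
  choose U hUo hxU hUb K hK hext using fun x : closure Ω => hΩ.exists_local_extension m I x.2
  have hcomp : IsCompact (closure Ω) := hΩ.isBounded.isCompact_closure
  obtain ⟨t, ht⟩ := hcomp.elim_finite_subcover U hUo fun x hx => mem_iUnion.2 ⟨⟨x, hx⟩, hxU ⟨x, hx⟩⟩
  obtain ⟨χ, hχ, hχc, hχU, hχ1⟩ := exists_contDiff_partition (κ := t) isClosed_closure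
    (fun i => U i) (fun i => hUo i) (fun i => hUb i) (ht.trans (by
      intro x hx
      simp only [mem_iUnion] at hx ⊢
      obtain ⟨i, hi, hxi⟩ := hx
      exact ⟨⟨i, hi⟩, hxi⟩))
  choose A hA hAb using fun i : t => BoundedDerivs.exists_of_hasCompactSupport_comp
    (dir := coordDir d) (ContinuousLinearMap.snd ℝ ℝ _) (hχ i) (hχc i) m
  refine ⟨∑ i : t, 2 ^ m * (A i * K i), Finset.sum_nonneg fun i _ =>
    mul_nonneg (by positivity) (mul_nonneg (hA i) (hK i)), fun f M hM hf => ?_⟩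
  choose F hFeq hF using fun i : t => hext i f M hM hf
  refine ⟨fun z => ∑ i, χ i z.2 * F i z, fun z hz => ?_, ?_⟩
  · have : ∀ i, χ i z.2 * F i z = χ i z.2 * f z := fun i => by
      by_cases h : z.2 ∈ U i
      · rw [hFeq i ⟨hz.1, hz.2, h⟩]
      · rw [image_eq_zero_of_notMem_tsupport fun h' => h (hχU i h'), zero_mul, zero_mul]
    simp only [this]
    rw [← Finset.sum_mul, hχ1 z.2 hz.2, one_mul]
  · rw [Finset.sum_mul]
    refine BoundedDerivs.sum Finset.univ fun i _ => ?_
    have hts : tsupport (fun z : SpaceTime d => χ i z.2) ⊆ Prod.snd ⁻¹' (U i) :=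
      (tsupport_comp_subset_preimage (χ i) continuous_snd).trans (preimage_mono (hχU i))
    have hset : (I ×ˢ (univ : Set (EuclideanSpace ℝ (Fin d)))) ∩ Prod.snd ⁻¹' (U i) = I ×ˢ U i := by
      ext z; simp
    have := BoundedDerivs.cutoff_mul (S := I ×ˢ univ) (mul_nonneg (hK i) hM) (hA i) hts (hAb i)
      ((hUo i).preimage continuous_snd) (by rw [hset]; exact hF i)
    exact this.mono_bound (le_of_eq (by ring))

/-- Reflection at the two ends of the interval, one after the other: first across `t = T`, then
across `t = 0` starting from the interval already enlarged. -/
theorem exists_time_extension (d m : ℕ) {T : ℝ} (hT : 0 < T) :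
    ∃ K, 0 ≤ K ∧ ∃ η, 0 < η ∧ ∀ (f : SpaceTime d → ℝ) (M : ℝ), 0 ≤ M →
      BoundedDerivs (coordDir d) (Icc 0 T ×ˢ univ) M m f →
      ∃ F : SpaceTime d → ℝ, EqOn F f (Icc 0 T ×ˢ univ) ∧
        BoundedDerivs (coordDir d) (Icc (-η) (T + η) ×ˢ univ) (K * M) m F := by
  let lam : Fin (m + 1) → ℝ := fun j => 1 + (j : ℕ)
  have hlam : Function.Injective lam := fun i j hij => by
    have : ((i : ℕ) : ℝ) = (j : ℕ) := by simpa [lam] using hij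
    exact Fin.ext (by exact_mod_cast this)
  obtain ⟨c, hc⟩ := exists_interpolation_coeffs hlam 0
  have hl1 : ∀ j, 0 ≤ lam j - 1 := fun j => by simp [lam]
  have hlm : ∀ j, lam j - 1 ≤ m := fun j => by
    have : ((j : ℕ) : ℝ) ≤ m := by exact_mod_cast Nat.lt_succ_iff.1 j.2
    simp only [lam]; linarith
  -- A point at distance `s ≤ η` outside an end is sent to distance `(lam j - 1) * s ≤ m * η ≤ T`
  -- inside it, so reflected points do not overshoot the other end.
  set η : ℝ := T / (m + 1) with hη
  have hη0 : 0 < η := by positivity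
  have hmη : m * η ≤ T := by
    rw [hη, mul_div_assoc', div_le_iff₀ (by positivity)]
    nlinarith
  have hprod : ∀ j s, 0 ≤ s → s ≤ η → 0 ≤ (lam j - 1) * s ∧ (lam j - 1) * s ≤ T := fun j s h0 h1 =>
    ⟨mul_nonneg (hl1 j) h0,
      (mul_le_mul (hlm j) h1 h0 (Nat.cast_nonneg m)).trans hmη⟩
  have hconst : ∀ (L : SpaceTime d →L[ℝ] ℝ) (P : Set (SpaceTime d)), ∃ A, 0 ≤ A ∧
      ∀ i, BoundedDerivs (coordDir d) P A m (fun _ => L (coordDir d i)) := fun L P =>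
    BoundedDerivs.exists_uniform_bound fun i =>
      ⟨_, abs_nonneg _, BoundedDerivs.const (L (coordDir d i)) le_rfl⟩
  set L := ContinuousLinearMap.fst ℝ ℝ (EuclideanSpace ℝ (Fin d)) with hL
  obtain ⟨A₁, hA₁, hb₁⟩ := hconst L (Icc 0 (T + η) ×ˢ univ)
  obtain ⟨A₂, hA₂, hb₂⟩ := hconst (-L) (Icc (-η) (T + η) ×ˢ univ)
  obtain ⟨K₁, hK₁, h₁⟩ := BoundedDerivs.exists_reflectExtend (dir := coordDir d)
    (S := Icc 0 T ×ˢ univ) (P := Icc 0 (T + η) ×ˢ univ) (ρ := fun z => L z - T)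
    (ρ' := fun _ => L) (e := ((1 : ℝ), 0)) (lam := lam) (sum_coordFun_smul_coordDir _).symm
    (fun z => L.hasFDerivAt.sub_const T)
    (fun z hz hz0 => ⟨⟨hz.1.1, by simpa [hL] using hz0⟩, trivial⟩)
    (fun z hz hz0 j => by
      refine ⟨?_, trivial⟩
      have h0 : 0 ≤ z.1 - T := hz0
      have h1 := hprod j (z.1 - T) h0 (by linarith [hz.1.2])
      change z.1 - (lam j * (z.1 - T)) * 1 ∈ Icc 0 T
      constructor <;> linarith [h1.1, h1.2]) hA₁ m hb₁ c 1 hc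
  obtain ⟨K₂, hK₂, h₂⟩ := BoundedDerivs.exists_reflectExtend (dir := coordDir d)
    (S := Icc 0 (T + η) ×ˢ univ) (P := Icc (-η) (T + η) ×ˢ univ) (ρ := fun z => -L z)
    (ρ' := fun _ => -L) (e := ((-1 : ℝ), 0)) (lam := lam) (sum_coordFun_smul_coordDir _).symm
    (fun z => L.hasFDerivAt.neg)
    (fun z hz hz0 => ⟨⟨by simpa [hL] using hz0, hz.1.2⟩, trivial⟩)
    (fun z hz hz0 j => by
      refine ⟨?_, trivial⟩
      have h0 : 0 ≤ -z.1 := hz0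
      have h1 := hprod j (-z.1) h0 (by linarith [hz.1.1])
      change z.1 - (lam j * (-z.1)) * (-1) ∈ Icc 0 (T + η)
      constructor <;> linarith [h1.1, h1.2]) hA₂ m hb₂ c 1 hc
  refine ⟨K₂ * K₁, mul_nonneg hK₂ hK₁, η, hη0, fun f M hM hf =>
    ⟨reflectExtend (fun z => -L z) ((-1 : ℝ), 0) lam c 1
      (reflectExtend (fun z => L z - T) ((1 : ℝ), 0) lam c 1 f), fun z hz => ?_, ?_⟩⟩
  · have h1 : -L z ≤ 0 := by simpa [hL] using hz.1.1
    have h2 : L z - T ≤ 0 := by simpa [hL] using hz.1.2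
    simp only [reflectExtend, if_pos h1, if_pos h2, one_mul]
  · rw [mul_assoc]
    exact h₂ _ _ (mul_nonneg hK₁ hM) (h₁ f M hM hf)

/-- Functions on the closed space-time cylinder extend to compactly supported functions on all of
space-time, with control of the derivatives. -/
theorem IsSmoothBoundedDomain.exists_extension (hΩ : IsSmoothBoundedDomain Ω) {T : ℝ} (hT : 0 < T)
    (m : ℕ) :
    ∃ K R, 0 ≤ K ∧ ∀ (f : SpaceTime d → ℝ) (M : ℝ), 0 ≤ M →
      BoundedDerivs (coordDir d) (Icc 0 T ×ˢ closure Ω) M m f →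
      ∃ F : SpaceTime d → ℝ, EqOn F f (Icc 0 T ×ˢ closure Ω) ∧
        BoundedDerivs (coordDir d) univ (K * M) m F ∧ ∀ z, F z ≠ 0 → ‖z‖ ≤ R := by
  obtain ⟨K₁, hK₁, h₁⟩ := hΩ.exists_space_extension m (Icc 0 T)
  obtain ⟨K₂, hK₂, η, hη, h₂⟩ := exists_time_extension d m hT
  have hcl : IsClosed (Icc 0 T ×ˢ closure Ω) := isClosed_Icc.prod isClosed_closure
  have hcomp : IsCompact (closure Ω) := hΩ.isBounded.isCompact_closure
  obtain ⟨r, hr⟩ := hcomp.isBounded.subset_ball 0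
  let U : Set (SpaceTime d) := Ioo (-η) (T + η) ×ˢ Metric.ball 0 r
  have hUo : IsOpen U := isOpen_Ioo.prod Metric.isOpen_ball
  have hUb : Bornology.IsBounded U := (Metric.isBounded_Ioo _ _).prod Metric.isBounded_ball
  obtain ⟨χ, hχ, hχc, hχU, hχ1⟩ := exists_contDiff_partition (κ := Unit) hcl (fun _ => U)
    (fun _ => hUo) (fun _ => hUb) (by
      rw [iUnion_const]
      exact prod_mono (Icc_subset_Ioo (by linarith) (by linarith)) hr)
  obtain ⟨A, hA, hAb⟩ := BoundedDerivs.exists_of_hasCompactSupport_comp (dir := coordDir d)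
    (ContinuousLinearMap.id ℝ (SpaceTime d)) (hχ ()) (hχc ()) m
  obtain ⟨R, hR⟩ := hUb.exists_norm_le
  refine ⟨2 ^ m * (A * (K₂ * K₁)), R, by positivity, fun f M hM hf => ?_⟩
  obtain ⟨F₁, hF₁, hb₁⟩ := h₁ f M hM hf
  obtain ⟨F₂, hF₂, hb₂⟩ := h₂ F₁ (K₁ * M) (mul_nonneg hK₁ hM) hb₁
  refine ⟨fun z => χ () z * F₂ z, fun z hz => ?_, ?_, fun z hz => ?_⟩
  · have : χ () z = 1 := by simpa using hχ1 z hz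
    simp only [this, one_mul]
    rw [hF₂ ⟨hz.1, trivial⟩, hF₁ hz]
  · have := BoundedDerivs.cutoff_mul (S := univ) (by positivity) hA (hχU ()) hAb hUo
      (hb₂.mono_set fun z hz => ⟨Ioo_subset_Icc_self hz.2.1, trivial⟩)
    exact this.mono_bound (le_of_eq (by ring))
  · refine hR z (hχU () (subset_tsupport _ fun h => hz ?_))
    simp [h]

end Extension

/-! ### An algebraic Jackson kernel -/

section Jackson

open Polynomial

/-- The polynomial `T_{2n+1}(x) / x`, where `T` denotes Chebyshev polynomials. -/
noncomputable def chebyshevQuotient (n : ℕ) : ℝ[X] := (Chebyshev.T ℝ (2 * n + 1 : ℤ)).divX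

/-- `T_{2n+1}` is odd, so up to sign it acts on sines as on cosines. Hence `T_{2n+1}(x) / x` at `x =
sin θ` is, up to sign, the Dirichlet kernel `sin ((2n+1) θ) / sin θ`, peaked at the origin. -/
theorem eval_chebyshev_sin (n : ℕ) (θ : ℝ) :
    |(Chebyshev.T ℝ (2 * n + 1 : ℤ)).eval (Real.sin θ)| = |Real.sin ((2 * n + 1) * θ)| := by
  rw [← Real.cos_pi_div_two_sub, Chebyshev.T_real_cos]
  push_cast
  have h : (2 * (n : ℝ) + 1) * (Real.pi / 2 - θ) =
      (Real.pi / 2 - (2 * n + 1) * θ) + n * Real.pi := by ring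
  rw [h, Real.cos_add_nat_mul_pi, Real.cos_pi_div_two_sub, abs_mul, abs_pow, abs_neg, abs_one,
    one_pow, one_mul]

theorem eval_chebyshevQuotient_mul (n : ℕ) (x : ℝ) :
    (chebyshevQuotient n).eval x * x = (Chebyshev.T ℝ (2 * n + 1 : ℤ)).eval x := by
  have h0 : (Chebyshev.T ℝ (2 * n + 1 : ℤ)).coeff 0 = 0 := by
    rw [coeff_zero_eq_eval_zero, ← abs_eq_zero, ← Real.sin_zero, eval_chebyshev_sin]
    simp
  have h := congrArg (eval x) (divX_mul_X_add (Chebyshev.T ℝ (2 * n + 1 : ℤ)))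
  rwa [h0, map_zero, add_zero, eval_mul, eval_X] at h

theorem natDegree_chebyshevQuotient_le (n : ℕ) : (chebyshevQuotient n).natDegree ≤ 2 * n := by
  rw [chebyshevQuotient, natDegree_divX_eq_natDegree_tsub_one, Chebyshev.natDegree_T]
  omega

theorem abs_chebyshevQuotient_mul_le (n : ℕ) {x : ℝ} (hx : |x| ≤ 1) :
    |(chebyshevQuotient n).eval x| * |x| ≤ 1 := by
  rw [← abs_mul, eval_chebyshevQuotient_mul]
  exact Chebyshev.abs_eval_T_real_le_one _ hx

/-- Jordan's inequality `sin y ≥ 2 y / π` is used twice, with `x = sin θ`: at `θ`, to get `(2n+1) θ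
≤ π / 2`, and at `(2n+1) θ`, to bound the numerator below. Then `2 / π ≥ 1 / 2`. -/
theorem le_abs_chebyshevQuotient (n : ℕ) {x : ℝ} (hx : 0 < x) (hx' : x ≤ 1 / (2 * n + 1)) :
    (2 * n + 1 : ℝ) / 2 ≤ |(chebyshevQuotient n).eval x| := by
  have hn : (0 : ℝ) < 2 * n + 1 := by positivity
  have hx1 : x ≤ 1 := hx'.trans ((div_le_one hn).2 (by linarith [Nat.cast_nonneg (α := ℝ) n]))
  set θ := Real.arcsin x with hθ
  have hsin : Real.sin θ = x := Real.sin_arcsin (by linarith) hx1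
  have hθ0 : 0 ≤ θ := Real.arcsin_nonneg.2 hx.le
  have hθ1 : θ ≤ Real.pi / 2 := Real.arcsin_le_pi_div_two x
  have hθx : 2 / Real.pi * θ ≤ x := hsin ▸ Real.mul_le_sin hθ0 hθ1
  have hxθ : x ≤ θ := hsin ▸ Real.sin_le hθ0
  have hpi := Real.pi_pos
  have hle : (2 * n + 1) * θ ≤ Real.pi / 2 := by
    have h1 : θ ≤ Real.pi / 2 * x := by
      rw [div_mul_eq_mul_div, div_le_iff₀ hpi] at hθx
      linarith
    have h2 : x * (2 * n + 1) ≤ 1 := by rwa [le_div_iff₀ hn] at hx'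
    calc (2 * n + 1) * θ ≤ (2 * n + 1) * (Real.pi / 2 * x) := by gcongr
      _ = Real.pi / 2 * (x * (2 * n + 1)) := by ring
      _ ≤ Real.pi / 2 * 1 := by gcongr
      _ = _ := mul_one _
  have hlow := Real.mul_le_sin (x := (2 * n + 1) * θ) (by positivity) hle
  have hT : (2 * n + 1 : ℝ) / 2 * x ≤ |(chebyshevQuotient n).eval x| * x := by
    have h1 : |(chebyshevQuotient n).eval x| * x = |Real.sin ((2 * n + 1) * θ)| := by
      rw [← eval_chebyshev_sin, hsin, ← eval_chebyshevQuotient_mul, abs_mul, abs_of_pos hx]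
    rw [h1]
    refine le_trans ?_ (hlow.trans (le_abs_self _))
    have h2 : (1 : ℝ) / 2 ≤ 2 / Real.pi := by
      rw [div_le_div_iff₀ (by norm_num) hpi]
      linarith [Real.pi_le_four]
    calc (2 * n + 1 : ℝ) / 2 * x = 1 / 2 * ((2 * n + 1) * x) := by ring
      _ ≤ 2 / Real.pi * ((2 * n + 1) * θ) := by gcongr
  exact le_of_mul_le_mul_right hT hx

/-- This integrand replaces `|x| * x ^ (-4)` away from the origin without a singularity, and has an
explicit antiderivative on each half-line. -/
theorem integral_abs_div_sq_add_sq_sq_le {h : ℝ} (hh : 0 < h) :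
    ∫ x in (-1 : ℝ)..1, |x| / (h ^ 2 + x ^ 2) ^ 2 ≤ 1 / h ^ 2 := by
  have hne : ∀ x : ℝ, h ^ 2 + x ^ 2 ≠ 0 := fun x => by positivity
  have hcont : Continuous fun x : ℝ => |x| / (h ^ 2 + x ^ 2) ^ 2 :=
    continuous_abs.div (by fun_prop) fun x => pow_ne_zero 2 (hne x)
  have hder : ∀ x : ℝ, HasDerivAt (fun x : ℝ => (h ^ 2 + x ^ 2)⁻¹ / 2)
      (-x / (h ^ 2 + x ^ 2) ^ 2) x := fun x => by
    have h1 : HasDerivAt (fun x : ℝ => h ^ 2 + x ^ 2) (2 * x) x := by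
      simpa using (hasDerivAt_pow 2 x).const_add (h ^ 2)
    refine ((h1.inv (hne x)).div_const 2).congr_deriv ?_
    field_simp
  rw [← intervalIntegral.integral_add_adjacent_intervals (b := 0) (hcont.intervalIntegrable _ _)
    (hcont.intervalIntegrable _ _)]
  have e1 : ∫ x in (-1 : ℝ)..0, |x| / (h ^ 2 + x ^ 2) ^ 2 =
      (h ^ 2)⁻¹ / 2 - (h ^ 2 + 1)⁻¹ / 2 := by
    rw [intervalIntegral.integral_eq_sub_of_hasDerivAt (f := fun x : ℝ => (h ^ 2 + x ^ 2)⁻¹ / 2) (fun x hx => ?_)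
      (hcont.intervalIntegrable _ _)]
    · norm_num
    · rw [uIcc_of_le (by norm_num)] at hx
      rw [abs_of_nonpos hx.2]
      exact hder x
  have e2 : ∫ x in (0 : ℝ)..1, |x| / (h ^ 2 + x ^ 2) ^ 2 =
      (h ^ 2)⁻¹ / 2 - (h ^ 2 + 1)⁻¹ / 2 := by
    rw [intervalIntegral.integral_eq_sub_of_hasDerivAt (f := fun x : ℝ => -((h ^ 2 + x ^ 2)⁻¹ / 2)) (fun x hx => ?_)
      (hcont.intervalIntegrable _ _)]
    · norm_num
      ring
    · rw [uIcc_of_le (by norm_num)] at hx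
      rw [abs_of_nonneg hx.1]
      exact (hder x).neg.congr_deriv (by ring)
  rw [e1, e2, one_div]
  have : 0 < (h ^ 2 + 1)⁻¹ := by positivity
  linarith

/-- Put `h = 1 / (2n+1)`. As `|q| ≥ 1 / (2h)` on `[h/2, h]`, the mass is at least `1 / (32 h³)`. In
the moment, the part `|x| ≤ h` costs at most `h` times the mass. Beyond `h`, the decay `|q| ≤ 1 /
|x|` contributes at most `4 / h²`, which is at most `128 h` times the mass; whence `129`. The fourth
power gives positivity and enough decay. -/
theorem integral_abs_mul_chebyshevQuotient_pow_le (n : ℕ) :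
    0 < ∫ x in (-1 : ℝ)..1, (chebyshevQuotient n).eval x ^ 4 ∧
    ∫ x in (-1 : ℝ)..1, |x| * (chebyshevQuotient n).eval x ^ 4 ≤
      129 / (2 * n + 1) * ∫ x in (-1 : ℝ)..1, (chebyshevQuotient n).eval x ^ 4 := by
  have hn : (0 : ℝ) < 2 * n + 1 := by positivity
  set q := chebyshevQuotient n with hq
  set h : ℝ := 1 / (2 * n + 1) with hh
  have hh0 : 0 < h := by positivity
  have hh1 : h ≤ 1 := (div_le_one hn).2 (by linarith [Nat.cast_nonneg (α := ℝ) n])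
  have hqc : Continuous fun x => q.eval x ^ 4 := by fun_prop
  have hlow : 1 / (32 * h ^ 3) ≤ ∫ x in (-1 : ℝ)..1, q.eval x ^ 4 := by
    have h1 : ∫ _ in (h / 2)..h, (1 / (16 * h ^ 4) : ℝ) ≤ ∫ x in (h / 2)..h, q.eval x ^ 4 := by
      refine intervalIntegral.integral_mono_on (by linarith) (by simp) (hqc.intervalIntegrable _ _) fun x hx => ?_
      have h2 : 1 / (2 * h) ≤ |q.eval x| := by
        have := le_abs_chebyshevQuotient n (x := x) (by linarith [hx.1]) hx.2
        refine le_trans (le_of_eq ?_) this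
        rw [hh]; field_simp
      calc 1 / (16 * h ^ 4) = (1 / (2 * h)) ^ 4 := by ring
        _ ≤ |q.eval x| ^ 4 := by gcongr
        _ = q.eval x ^ 4 := by
          rw [← abs_pow]; exact abs_of_nonneg (by positivity)
    have h3 : ∫ x in (h / 2)..h, q.eval x ^ 4 ≤ ∫ x in (-1 : ℝ)..1, q.eval x ^ 4 :=
      intervalIntegral.integral_mono_interval (by linarith) (by linarith) hh1
        (Filter.Eventually.of_forall fun x => by positivity) (hqc.intervalIntegrable _ _)
    refine le_trans (le_of_eq ?_) (h1.trans h3)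
    rw [intervalIntegral.integral_const, smul_eq_mul]
    field_simp
    ring
  refine ⟨lt_of_lt_of_le (by positivity) hlow, ?_⟩
  have hne : ∀ x : ℝ, (h ^ 2 + x ^ 2) ^ 2 ≠ 0 := fun x => by positivity
  have hgc : Continuous fun x : ℝ => |x| / (h ^ 2 + x ^ 2) ^ 2 :=
    continuous_abs.div (by fun_prop) hne
  have hpt : ∀ x ∈ Icc (-1 : ℝ) 1,
      |x| * q.eval x ^ 4 ≤ h * q.eval x ^ 4 + 4 * (|x| / (h ^ 2 + x ^ 2) ^ 2) := by
    intro x hx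
    have hq0 : 0 ≤ q.eval x ^ 4 := by positivity
    have hg0 : 0 ≤ 4 * (|x| / (h ^ 2 + x ^ 2) ^ 2) := by positivity
    rcases le_or_gt |x| h with hxh | hxh
    · have := mul_le_mul_of_nonneg_right hxh hq0
      linarith
    · have hx0 : 0 < |x| := hh0.trans hxh
      have h1 := abs_chebyshevQuotient_mul_le n (abs_le.2 hx)
      have h2 : q.eval x ^ 4 * |x| ^ 4 ≤ 1 := by
        have : q.eval x ^ 4 = |q.eval x| ^ 4 := by
          rw [← abs_pow]; exact (abs_of_nonneg (by positivity)).symm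
        rw [this, ← mul_pow]
        exact pow_le_one₀ (by positivity) h1
      have h3 : (h ^ 2 + x ^ 2) ^ 2 ≤ 4 * |x| ^ 4 := by
        have : h ^ 2 ≤ |x| ^ 2 := by gcongr
        rw [← sq_abs x]
        nlinarith [sq_nonneg h, sq_nonneg (|x|)]
      have h4 : |x| * q.eval x ^ 4 ≤ 4 * (|x| / (h ^ 2 + x ^ 2) ^ 2) := by
        rw [mul_div_assoc', le_div_iff₀ (by positivity)]
        calc |x| * q.eval x ^ 4 * (h ^ 2 + x ^ 2) ^ 2 ≤ |x| * q.eval x ^ 4 * (4 * |x| ^ 4) := by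
              gcongr
          _ = 4 * |x| * (q.eval x ^ 4 * |x| ^ 4) := by ring
          _ ≤ 4 * |x| * 1 := by gcongr
          _ = 4 * |x| := mul_one _
      have := mul_nonneg hh0.le hq0
      linarith
  have hqi : IntervalIntegrable (fun x => h * q.eval x ^ 4) volume (-1) 1 :=
    (continuous_const.mul hqc).intervalIntegrable _ _
  have hgi : IntervalIntegrable (fun x => 4 * (|x| / (h ^ 2 + x ^ 2) ^ 2)) volume (-1) 1 :=
    (continuous_const.mul hgc).intervalIntegrable _ _
  have hint : ∫ x in (-1 : ℝ)..1, |x| * q.eval x ^ 4 ≤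
      ∫ x in (-1 : ℝ)..1, (h * q.eval x ^ 4 + 4 * (|x| / (h ^ 2 + x ^ 2) ^ 2)) :=
    intervalIntegral.integral_mono_on (by norm_num)
      ((continuous_abs.mul hqc).intervalIntegrable _ _) (hqi.add hgi) hpt
  rw [intervalIntegral.integral_add hqi hgi, intervalIntegral.integral_const_mul,
    intervalIntegral.integral_const_mul] at hint
  have hb := integral_abs_div_sq_add_sq_sq_le hh0
  have h5 : 1 / h ^ 2 ≤ 32 * h * ∫ x in (-1 : ℝ)..1, q.eval x ^ 4 := by
    calc 1 / h ^ 2 = 32 * h * (1 / (32 * h ^ 3)) := by field_simp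
      _ ≤ _ := by gcongr
  have h6 : 129 / (2 * n + 1 : ℝ) = 129 * h := by rw [hh]; ring
  rw [h6]
  linarith

/-- Positive polynomial kernels of degree at most `8 n` on `[-b, b]` with first absolute moment of
order `b / n`. -/
theorem exists_jackson_kernel {b : ℝ} (hb : 0 < b) {n : ℕ} (hn : 1 ≤ n) :
    ∃ p : ℝ[X], p.natDegree ≤ 8 * n ∧ (∀ x, 0 ≤ p.eval x) ∧ ∫ x in (-b)..b, p.eval x = 1 ∧
      ∫ x in (-b)..b, |x| * p.eval x ≤ 129 * b / n := by
  obtain ⟨hpos, hle⟩ := integral_abs_mul_chebyshevQuotient_pow_le n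
  set I := ∫ x in (-1 : ℝ)..1, (chebyshevQuotient n).eval x ^ 4 with hI
  have hev : ∀ x, (C (b⁻¹ * I⁻¹) * ((chebyshevQuotient n) ^ 4).comp (C b⁻¹ * X)).eval x =
      b⁻¹ * (I⁻¹ * (chebyshevQuotient n).eval (x / b) ^ 4) := fun x => by
    simp only [eval_mul, eval_C, eval_comp, eval_pow, eval_X]
    rw [div_eq_inv_mul, mul_assoc]
  refine ⟨C (b⁻¹ * I⁻¹) * ((chebyshevQuotient n) ^ 4).comp (C b⁻¹ * X), ?_, fun x => ?_, ?_, ?_⟩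
  · refine (natDegree_C_mul_le _ _).trans ?_
    rw [natDegree_comp]
    have h1 : ((chebyshevQuotient n) ^ 4).natDegree ≤ 4 * (2 * n) :=
      natDegree_pow_le.trans (Nat.mul_le_mul_left 4 (natDegree_chebyshevQuotient_le n))
    have h2 : (C b⁻¹ * X : ℝ[X]).natDegree ≤ 1 := (natDegree_C_mul_le _ _).trans natDegree_X_le
    calc _ ≤ 4 * (2 * n) * 1 := Nat.mul_le_mul h1 h2
      _ = 8 * n := by ring
  · rw [hev]
    positivity
  · simp only [hev]
    rw [intervalIntegral.integral_const_mul, intervalIntegral.integral_const_mul,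
      intervalIntegral.integral_comp_div (fun x => (chebyshevQuotient n).eval x ^ 4) hb.ne', neg_div, div_self hb.ne',
      smul_eq_mul, ← hI]
    field_simp
  · have h1 : ∀ x, |x| * (b⁻¹ * (I⁻¹ * (chebyshevQuotient n).eval (x / b) ^ 4)) =
        I⁻¹ * (|x / b| * (chebyshevQuotient n).eval (x / b) ^ 4) := fun x => by
      rw [abs_div, abs_of_pos hb]
      field_simp
    simp only [hev, h1]
    rw [intervalIntegral.integral_const_mul,
      intervalIntegral.integral_comp_div (fun x => |x| * (chebyshevQuotient n).eval x ^ 4) hb.ne', neg_div,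
      div_self hb.ne', smul_eq_mul]
    have hn0 : (0 : ℝ) < n := by exact_mod_cast hn
    calc I⁻¹ * (b * ∫ x in (-1 : ℝ)..1, |x| * (chebyshevQuotient n).eval x ^ 4)
        ≤ I⁻¹ * (b * (129 / (2 * n + 1) * I)) := by gcongr
      _ = 129 * b / (2 * n + 1) := by field_simp
      _ ≤ 129 * b / n := by gcongr; linarith

end Jackson

/-! ### Approximation by convolution with a product kernel -/

section Convolution

variable {V : Type*} [NormedAddCommGroup V] [NormedSpace ℝ V] {ι : Type*} [Fintype ι]

/-- The average of `F` over translations along the directions `dir i` with product weight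
`∏ i, k (u i)`. -/
noncomputable def kernelAverage (dir : ι → V) (k : ℝ → ℝ) (F : V → ℝ) (z : V) : ℝ :=
  ∫ u : ι → ℝ, (∏ i, k (u i)) * F (z - ∑ i, u i • dir i)

variable {dir : ι → V} {co : ι → V →L[ℝ] ℝ} {k : ℝ → ℝ} {M μ : ℝ} {F : V → ℝ} {m : ℕ}

theorem integrable_prod_kernel (hk : Integrable k) :
    Integrable fun u : ι → ℝ => ∏ i, k (u i) :=
  Integrable.fintype_prod (f := fun _ => k) fun _ => hk

/-- The factor `|u i|` is absorbed into the `i`-th kernel, so that first moments factor by Fubini.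
-/
theorem abs_mul_prod_kernel_eq [DecidableEq ι] (i : ι) (u : ι → ℝ) :
    |u i| * ∏ j, k (u j) = ∏ j, (if j = i then fun x => |x| * k x else k) (u j) := by
  have h : ∀ j, (if j = i then fun x => |x| * k x else k) (u j) =
      (if j = i then |u j| else 1) * k (u j) := fun j => by split_ifs <;> simp
  simp only [h, Finset.prod_mul_distrib, Finset.prod_ite_eq', Finset.mem_univ, if_true]

theorem integrable_abs_mul_prod_kernel (hk : Integrable k) (hk₁ : Integrable fun x => |x| * k x)
    (i : ι) : Integrable fun u : ι → ℝ => |u i| * ∏ j, k (u j) := by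
  classical
  simp only [abs_mul_prod_kernel_eq]
  refine Integrable.fintype_prod (f := fun j => if j = i then fun x => |x| * k x else k) fun j => ?_
  split_ifs
  · exact hk₁
  · exact hk

theorem integral_abs_mul_prod_kernel (h1 : ∫ x, k x = 1) (i : ι) :
    ∫ u : ι → ℝ, |u i| * ∏ j, k (u j) = ∫ x, |x| * k x := by
  classical
  simp only [abs_mul_prod_kernel_eq]
  rw [integral_fintype_prod_volume_eq_prod fun j => if j = i then fun x => |x| * k x else k]
  have h : ∀ j, ∫ x, (if j = i then fun x => |x| * k x else k) x =
      if j = i then ∫ x, |x| * k x else 1 := fun j => by split_ifs <;> simp [h1]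
  simp only [h, Finset.prod_ite_eq', Finset.mem_univ, if_true]

theorem integrable_prod_kernel_mul (hk : Integrable k) {G : V → ℝ} (hG : Continuous G)
    (hb : ∀ z, |G z| ≤ M) (z : V) :
    Integrable fun u : ι → ℝ => (∏ i, k (u i)) * G (z - ∑ i, u i • dir i) := by
  have hc : Continuous fun u : ι → ℝ => G (z - ∑ i, u i • dir i) := by fun_prop
  exact (integrable_prod_kernel hk).mul_bdd hc.aestronglyMeasurable
    (Filter.Eventually.of_forall fun u => hb _)

theorem abs_sub_translate_le {F' : V → V →L[ℝ] ℝ} (hF' : ∀ z, HasFDerivAt F (F' z) z)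
    (hb : ∀ i z, |F' z (dir i)| ≤ M) (z : V) (u : ι → ℝ) :
    |F z - F (z - ∑ i, u i • dir i)| ≤ M * ∑ i, |u i| := by
  set h := ∑ i, u i • dir i with hh
  have hder : ∀ t : ℝ, HasDerivAt (fun t : ℝ => F (z - t • h)) (F' (z - t • h) (-h)) t := fun t => by
    have h1 : HasDerivAt (fun t : ℝ => z - t • h) (-h) t := by
      simpa using ((hasDerivAt_id t).smul_const h).const_sub z
    exact (hF' _).comp_hasDerivAt t h1
  have := norm_image_sub_le_of_norm_deriv_le_segment_01' (f := fun t : ℝ => F (z - t • h))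
    (C := M * ∑ i, |u i|) (fun t _ => (hder t).hasDerivWithinAt) fun t _ => by
      rw [map_neg, norm_neg, hh, map_sum, Real.norm_eq_abs, Finset.mul_sum]
      refine (Finset.abs_sum_le_sum_abs _ _).trans (Finset.sum_le_sum fun i _ => ?_)
      rw [map_smul, smul_eq_mul, abs_mul, mul_comm]
      exact mul_le_mul_of_nonneg_right (hb i _) (abs_nonneg _)
  simpa [abs_sub_comm] using this

/-- The weight has mass one, so the error is the average of `F z - F (z - ∑ i, u i • dir i)`. This
is at most `M * ∑ i, |u i|`, and each `|u i|` has mean at most `μ`. -/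
theorem abs_sub_kernelAverage_le (hk : Integrable k) (hk₁ : Integrable fun x => |x| * k x)
    (hk0 : ∀ x, 0 ≤ k x) (h1 : ∫ x, k x = 1) (hμ : ∫ x, |x| * k x ≤ μ)
    (hM : 0 ≤ M) {F' : V → V →L[ℝ] ℝ} (hF' : ∀ z, HasFDerivAt F (F' z) z) (hFb : ∀ z, |F z| ≤ M)
    (hb : ∀ i z, |F' z (dir i)| ≤ M) (z : V) :
    |F z - kernelAverage dir k F z| ≤ Fintype.card ι * μ * M := by
  have hFc : Continuous F := continuous_iff_continuousAt.2 fun z => (hF' z).continuousAt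
  have hone : ∫ u : ι → ℝ, ∏ i, k (u i) = 1 := by
    rw [integral_fintype_prod_volume_eq_prod fun _ => k]; simp [h1]
  have hi := integrable_prod_kernel_mul (dir := dir) hk hFc hFb z
  have e1 : F z - kernelAverage dir k F z =
      ∫ u : ι → ℝ, (∏ i, k (u i)) * (F z - F (z - ∑ i, u i • dir i)) := by
    simp only [mul_sub]
    rw [integral_sub ((integrable_prod_kernel hk).mul_const _) hi, integral_mul_const, hone, one_mul]
    rfl
  have hbound : Integrable fun u : ι → ℝ => ∑ i, M * (|u i| * ∏ j, k (u j)) :=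
    integrable_finsetSum _ fun i _ => (integrable_abs_mul_prod_kernel hk hk₁ i).const_mul M
  rw [e1, ← Real.norm_eq_abs]
  refine (norm_integral_le_of_norm_le hbound (Filter.Eventually.of_forall fun u => ?_)).trans ?_
  · have hw : 0 ≤ ∏ i, k (u i) := Finset.prod_nonneg fun i _ => hk0 _
    rw [Real.norm_eq_abs, abs_mul, abs_of_nonneg hw]
    refine (mul_le_mul_of_nonneg_left (abs_sub_translate_le hF' hb z u) hw).trans (le_of_eq ?_)
    rw [Finset.mul_sum, Finset.mul_sum]
    exact Finset.sum_congr rfl fun i _ => by ring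
  · rw [integral_finsetSum _ fun i _ => (integrable_abs_mul_prod_kernel hk hk₁ i).const_mul M]
    simp only [integral_const_mul, integral_abs_mul_prod_kernel h1]
    rw [Finset.sum_const, Finset.card_univ, nsmul_eq_mul, mul_assoc, mul_comm M]
    gcongr

/-- All derivatives fall on `F`, so averaging commutes with partial derivatives even for a kernel
with jumps. The dual functionals `co` recover `F'` from its partial derivatives, which supplies
continuity and the dominating bound. -/
theorem hasFDerivAt_kernelAverage (hk : Integrable k) (hk0 : ∀ x, 0 ≤ k x)
    (hco : ∀ z, ∑ i, co i z • dir i = z) {F' : V → V →L[ℝ] ℝ}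
    (hF' : ∀ z, HasFDerivAt F (F' z) z) (hFb : ∀ z, |F z| ≤ M)
    (hc : ∀ i, Continuous fun z => F' z (dir i)) (hb : ∀ i z, |F' z (dir i)| ≤ M) (z : V) :
    ∃ L : V →L[ℝ] ℝ, HasFDerivAt (kernelAverage dir k F) L z ∧
      ∀ i, L (dir i) = kernelAverage dir k (fun z => F' z (dir i)) z := by
  have hFc : Continuous F := continuous_iff_continuousAt.2 fun z => (hF' z).continuousAt
  have hF'eq : ∀ z, F' z = ∑ i, F' z (dir i) • co i := fun z => by
    ext v
    conv_lhs => rw [← hco v]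
    simp [mul_comm]
  have hF'c : Continuous F' := by
    have : F' = fun z => ∑ i, F' z (dir i) • co i := funext hF'eq
    rw [this]
    exact continuous_finsetSum _ fun i _ => (hc i).smul continuous_const
  have hF'b : ∀ z, ‖F' z‖ ≤ ∑ i, M * ‖co i‖ := fun z => by
    rw [hF'eq z]
    refine (norm_sum_le _ _).trans (Finset.sum_le_sum fun i _ => ?_)
    rw [norm_smul]
    exact mul_le_mul_of_nonneg_right (hb i z) (norm_nonneg _)
  have hw : ∀ u : ι → ℝ, 0 ≤ ∏ i, k (u i) := fun u => Finset.prod_nonneg fun i _ => hk0 _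
  have hwi := integrable_prod_kernel (ι := ι) hk
  have hτc : Continuous fun u : ι → ℝ => z - ∑ i, u i • dir i := by fun_prop
  have hF'm : AEStronglyMeasurable
      (fun u : ι → ℝ => (∏ i, k (u i)) • F' (z - ∑ i, u i • dir i)) volume :=
    hwi.aestronglyMeasurable.smul (hF'c.comp hτc).aestronglyMeasurable
  have hF'i : Integrable fun u : ι → ℝ => (∏ i, k (u i)) • F' (z - ∑ i, u i • dir i) := by
    refine (hwi.mul_const (∑ i, M * ‖co i‖)).mono' hF'm (Filter.Eventually.of_forall fun u => ?_)
    rw [norm_smul, Real.norm_eq_abs, abs_of_nonneg (hw u)]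
    exact mul_le_mul_of_nonneg_left (hF'b _) (hw u)
  refine ⟨_, hasFDerivAt_integral_of_dominated_of_fderiv_le (s := univ)
    (F := fun z (u : ι → ℝ) => (∏ i, k (u i)) * F (z - ∑ i, u i • dir i))
    (F' := fun z (u : ι → ℝ) => (∏ i, k (u i)) • F' (z - ∑ i, u i • dir i))
    (bound := fun u => (∏ i, k (u i)) * ∑ i, M * ‖co i‖) Filter.univ_mem
    (Filter.Eventually.of_forall fun y =>
      (integrable_prod_kernel_mul hk hFc hFb y).aestronglyMeasurable)
    (integrable_prod_kernel_mul hk hFc hFb z) hF'm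
    (Filter.Eventually.of_forall fun u y _ => ?_) (hwi.mul_const _)
    (Filter.Eventually.of_forall fun u y _ => ?_), fun i => ?_⟩
  · rw [norm_smul, Real.norm_eq_abs, abs_of_nonneg (hw u)]
    exact mul_le_mul_of_nonneg_left (hF'b _) (hw u)
  · have h1 : HasFDerivAt (fun y => F (y - ∑ i, u i • dir i)) (F' (y - ∑ i, u i • dir i)) y :=
      (hF' _).comp y ((hasFDerivAt_id y).sub_const _)
    exact h1.const_mul _
  · rw [ContinuousLinearMap.integral_apply hF'i]
    rfl

/-- Since averaging commutes with `∂_i`, the zeroth-order estimate applies to every derivative of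
order at most `m`; each use consumes one further derivative. -/
theorem BoundedDerivs.sub_kernelAverage (hk : Integrable k) (hk₁ : Integrable fun x => |x| * k x)
    (hk0 : ∀ x, 0 ≤ k x) (h1 : ∫ x, k x = 1) (hμ : ∫ x, |x| * k x ≤ μ) (hM : 0 ≤ M)
    (hco : ∀ z, ∑ i, co i z • dir i = z) (hF : BoundedDerivs dir univ M (m + 1) F) :
    BoundedDerivs dir univ (Fintype.card ι * μ * M) m
      (fun z => F z - kernelAverage dir k F z) := by
  induction m generalizing F with
  | zero =>
    obtain ⟨F0, F', hF', Fi⟩ := hF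
    have hF'' : ∀ z, HasFDerivAt F (F' z) z := fun z => hasFDerivWithinAt_univ.1 (hF' z trivial)
    have hd : ∀ z, ContinuousAt (fun z => F z - kernelAverage dir k F z) z := fun z => by
      obtain ⟨L, hL, -⟩ := hasFDerivAt_kernelAverage hk hk0 hco hF'' (fun z => F0 z trivial)
        (fun i => continuousOn_univ.1 (Fi i).continuousOn) (fun i z => (Fi i).abs_le z trivial) z
      exact (hF'' z).continuousAt.sub hL.continuousAt
    exact ⟨fun z _ => (hd z).continuousWithinAt, fun z _ =>
      abs_sub_kernelAverage_le hk hk₁ hk0 h1 hμ hM hF'' (fun z => F0 z trivial)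
        (fun i z => (Fi i).abs_le z trivial) z⟩
  | succ m ih =>
    obtain ⟨F0, F', hF', Fi⟩ := hF
    have hF'' : ∀ z, HasFDerivAt F (F' z) z := fun z => hasFDerivWithinAt_univ.1 (hF' z trivial)
    choose L hL hLi using hasFDerivAt_kernelAverage hk hk0 hco hF'' (fun z => F0 z trivial)
        (fun i => continuousOn_univ.1 (Fi i).continuousOn) (fun i z => (Fi i).abs_le z trivial)
    refine ⟨fun z _ => abs_sub_kernelAverage_le hk hk₁ hk0 h1 hμ hM hF'' (fun z => F0 z trivial)
        (fun i z => (Fi i).abs_le z trivial) z, fun z => F' z - L z,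
      fun z _ => ((hF'' z).sub (hL z)).hasFDerivWithinAt, fun i => ?_⟩
    refine (ih (Fi i)).congr fun z _ => ?_
    simp [hLi]

/-- A kernel average of a compactly supported function agrees, on bounded sets, with a polynomial if
the kernel is polynomial near the origin. -/
theorem exists_kernelAverage_eq_sum [DecidableEq ι] {b : ℝ} (hco : ∀ z, ∑ i, co i z • dir i = z)
    (hdual : ∀ (u : ι → ℝ) i, co i (∑ j, u j • dir j) = u i) (hF : Continuous F)
    (hsupp : ∀ z, F z ≠ 0 → ∀ i, |co i z| ≤ b) {p : Polynomial ℝ} {n : ℕ} (hp : p.natDegree ≤ n) :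
    ∃ β : (ι → Fin (n + 1)) → ℝ, ∀ z, (∀ i, |co i z| ≤ b) →
      kernelAverage dir (indicator (Icc (-(2 * b)) (2 * b)) fun x => p.eval x) F z =
        ∑ α, β α * ∏ i, co i z ^ (α i : ℕ) := by
  let G : (ι → ℝ) → ℝ := fun y => F (∑ j, y j • dir j)
  have hGc : Continuous G := by fun_prop
  have hGs : HasCompactSupport G := by
    refine HasCompactSupport.intro (isCompact_univ_pi fun _ : ι => isCompact_Icc (a := -b) (b := b))
      fun y hy => ?_
    by_contra h
    exact hy fun i _ => abs_le.1 (by simpa [hdual] using hsupp _ h i)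
  let γ : (ι → Fin (n + 1)) → (ι → ℝ) → ℝ := fun α y =>
    G y * ∏ i, (Polynomial.hasseDeriv (α i : ℕ) p).eval (-y i)
  have hγi : ∀ α, Integrable (γ α) := fun α => by
    have hc : Continuous (γ α) := by fun_prop
    exact hc.integrable_of_hasCompactSupport hGs.mul_right
  refine ⟨fun α => ∫ y, γ α y, fun z hz => ?_⟩
  -- Taylor's formula for `p` at `-y` separates the variables: a polynomial in `x` with coefficients
  -- depending on `y`.
  have heval : ∀ x y : ℝ, p.eval (x - y) =
      ∑ l : Fin (n + 1), (Polynomial.hasseDeriv (l : ℕ) p).eval (-y) * x ^ (l : ℕ) := fun x y => by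
    rw [sub_eq_add_neg, ← Polynomial.taylor_eval,
      Polynomial.eval_eq_sum_range' (n := n + 1) (by rw [Polynomial.natDegree_taylor]; omega),
      Finset.sum_range]
    simp only [Polynomial.taylor_coeff]
  have hint : kernelAverage dir (indicator (Icc (-(2 * b)) (2 * b)) fun x => p.eval x) F z =
      ∫ y : ι → ℝ, G y * ∏ i, p.eval (co i z - y i) := by
    rw [← integral_sub_left_eq_self _ volume (fun i => co i z)]
    refine integral_congr_ae (Filter.Eventually.of_forall fun u => ?_)
    have hpt : z - ∑ i, u i • dir i = ∑ i, (co i z - u i) • dir i := by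
      simp only [sub_smul, Finset.sum_sub_distrib, hco]
    simp only [hpt, G, Pi.sub_apply, sub_sub_cancel]
    -- Where `F` does not vanish, `z` and the translated point both have coordinates in `[-b, b]`,
    -- so `|u i| ≤ 2 b` and the truncation of the kernel is not felt.
    by_cases h : F (∑ i, (co i z - u i) • dir i) = 0
    · rw [h, mul_zero, zero_mul]
    · rw [mul_comm]
      congr 1
      refine Finset.prod_congr rfl fun i _ => indicator_of_mem ?_ _
      have h1 := hsupp _ h i
      rw [hdual fun i => co i z - u i] at h1
      have h2 := abs_le.1 h1
      have h3 := abs_le.1 (hz i)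
      constructor <;> linarith [h2.1, h2.2, h3.1, h3.2]
  rw [hint]
  have hexp : ∀ y : ι → ℝ, G y * ∏ i, p.eval (co i z - y i) =
      ∑ α : ι → Fin (n + 1), γ α y * ∏ i, co i z ^ (α i : ℕ) := fun y => by
    simp only [heval, Fintype.prod_sum, Finset.mul_sum, Finset.prod_mul_distrib, γ, mul_assoc]
  simp only [hexp]
  rw [integral_finsetSum _ fun α _ => (hγi α).mul_const _]
  simp only [integral_mul_const]

/-- **Jackson's theorem**: simultaneous approximation of a function and its derivatives by
polynomials of degree at most `8 n` in each coordinate. -/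
theorem BoundedDerivs.exists_polynomial_approx [DecidableEq ι] {b : ℝ} (hb : 0 < b)
    (hM : 0 ≤ M) (hco : ∀ z, ∑ i, co i z • dir i = z)
    (hdual : ∀ (u : ι → ℝ) i, co i (∑ j, u j • dir j) = u i)
    (hF : BoundedDerivs dir univ M (m + 1) F) (hsupp : ∀ z, F z ≠ 0 → ∀ i, |co i z| ≤ b)
    {n : ℕ} (hn : 1 ≤ n) :
    ∃ β : (ι → Fin (8 * n + 1)) → ℝ,
      BoundedDerivs dir {z | ∀ i, |co i z| ≤ b} (Fintype.card ι * (129 * (2 * b) / n) * M) m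
        (fun z => F z - ∑ α, β α * ∏ i, co i z ^ (α i : ℕ)) := by
  obtain ⟨p, hdeg, hp0, hp1, hpm⟩ := exists_jackson_kernel (b := 2 * b) (by positivity) hn
  have hle : -(2 * b) ≤ 2 * b := by linarith
  set k : ℝ → ℝ := indicator (Icc (-(2 * b)) (2 * b)) fun x => p.eval x with hk
  have hkm : (fun x => |x| * k x) = indicator (Icc (-(2 * b)) (2 * b)) fun x => |x| * p.eval x := by
    ext x
    simp only [hk, indicator]
    split_ifs <;> simp
  have hki : Integrable k := by
    refine (integrable_indicator_iff measurableSet_Icc).2 ?_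
    exact (by fun_prop : Continuous fun x => p.eval x).continuousOn.integrableOn_Icc
  have hki₁ : Integrable fun x => |x| * k x := by
    rw [hkm]
    refine (integrable_indicator_iff measurableSet_Icc).2 ?_
    exact (by fun_prop : Continuous fun x => |x| * p.eval x).continuousOn.integrableOn_Icc
  have hk1 : ∫ x, k x = 1 := by
    rw [hk, integral_indicator measurableSet_Icc, integral_Icc_eq_integral_Ioc,
      ← intervalIntegral.integral_of_le hle, hp1]
  have hkμ : ∫ x, |x| * k x ≤ 129 * (2 * b) / n := by
    rw [hkm, integral_indicator measurableSet_Icc, integral_Icc_eq_integral_Ioc,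
      ← intervalIntegral.integral_of_le hle]
    exact hpm
  obtain ⟨β, hβ⟩ := exists_kernelAverage_eq_sum hco hdual
    (continuousOn_univ.1 hF.continuousOn) hsupp hdeg
  refine ⟨β, ?_⟩
  have h := BoundedDerivs.sub_kernelAverage hki hki₁
    (fun x => indicator_nonneg (fun x _ => hp0 x) x) hk1 hkμ hM hco hF
  refine (h.mono_set (subset_univ {z | ∀ i, |co i z| ≤ b})).congr fun z hz => ?_
  change F z - _ = F z - kernelAverage dir k F z
  rw [hk, hβ z hz]

end Convolution

/-! ### Smooth activation functions -/

section Activation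

open Polynomial in
theorem exists_derivative_eq (p : ℝ[X]) : ∃ P : ℝ[X], derivative P = p := by
  induction p using Polynomial.induction_on' with
  | add p q hp hq =>
    obtain ⟨P, rfl⟩ := hp
    obtain ⟨R, rfl⟩ := hq
    exact ⟨P + R, derivative_add⟩
  | monomial n a =>
    refine ⟨monomial (n + 1) (a / (n + 1)), ?_⟩
    rw [derivative_monomial]
    congr 1
    push_cast
    field_simp

open Polynomial in
theorem exists_polynomial_of_deriv {σ : ℝ → ℝ} (hσ : Differentiable ℝ σ)
    (h : ∃ p : ℝ[X], ∀ y, deriv σ y = p.eval y) : ∃ p : ℝ[X], ∀ y, σ y = p.eval y := by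
  obtain ⟨p, hp⟩ := h
  obtain ⟨P, hP⟩ := exists_derivative_eq p
  have hc := is_const_of_deriv_eq_zero (f := fun y => σ y - P.eval y) (hσ.sub P.differentiable)
    fun y => by
      rw [deriv_fun_sub (hσ y) P.differentiableAt, hp, Polynomial.deriv, hP, sub_self]
  refine ⟨P + C (σ 0 - P.eval 0), fun y => ?_⟩
  have := hc y 0
  simp only [eval_add, eval_C]
  linarith

/-- A smooth function that is not a polynomial has a point where its first derivatives do not
vanish. -/
theorem exists_iteratedDeriv_ne_zero {σ : ℝ → ℝ} (hσ : ContDiff ℝ ∞ σ)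
    (hp : ¬ ∃ p : Polynomial ℝ, ∀ y, σ y = p.eval y) (J : ℕ) :
    ∃ x, ∀ j ≤ J, iteratedDeriv j σ x ≠ 0 := by
  -- An open set of such points is needed to run the induction through `deriv σ`.
  suffices h : ∃ U : Set ℝ, IsOpen U ∧ U.Nonempty ∧ ∀ x ∈ U, ∀ j ≤ J, iteratedDeriv j σ x ≠ 0 by
    obtain ⟨U, -, ⟨x, hx⟩, h⟩ := h
    exact ⟨x, h x hx⟩
  induction J generalizing σ with
  | zero =>
    refine ⟨{x | σ x ≠ 0}, isOpen_ne_fun hσ.continuous continuous_const, ?_, fun x hx j hj => ?_⟩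
    · by_contra h
      refine hp ⟨0, fun y => ?_⟩
      by_contra hy
      exact h ⟨y, by simpa using hy⟩
    · obtain rfl : j = 0 := by omega
      simpa using hx
  | succ J ih =>
    have hd : ContDiff ℝ ∞ (deriv σ) := hσ.deriv'
    obtain ⟨U, hU, hne, h⟩ := ih hd fun h =>
      hp (exists_polynomial_of_deriv (hσ.differentiable (by simp)) h)
    refine ⟨U ∩ {x | σ x ≠ 0}, hU.inter (isOpen_ne_fun hσ.continuous continuous_const), ?_, ?_⟩
    -- If `σ` vanished on all of `U`, so would `deriv σ`, against the choice of `U`.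
    · by_contra hemp
      obtain ⟨x, hx⟩ := hne
      have hz : σ =ᶠ[𝓝 x] fun _ => 0 := by
        filter_upwards [hU.mem_nhds hx] with y hy
        by_contra hy0
        exact hemp ⟨y, hy, hy0⟩
      refine h x hx 0 (Nat.zero_le _) ?_
      rw [iteratedDeriv_zero, hz.deriv_eq, deriv_const]
    · rintro x ⟨hxU, hx0⟩ j hj
      cases j with
      | zero => simpa using hx0
      | succ j =>
        rw [iteratedDeriv_succ']
        exact h x hxU j (by omega)

/-- The remainder of the Taylor polynomial of degree `s` at `b`, as a function of the increment. -/
noncomputable def taylorRemainder (σ : ℝ → ℝ) (b : ℝ) (s : ℕ) (y : ℝ) : ℝ :=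
  σ (b + y) - ∑ j ∈ Finset.range (s + 1), iteratedDeriv j σ b / j.factorial * y ^ j

theorem contDiff_taylorRemainder {σ : ℝ → ℝ} (hσ : ContDiff ℝ ∞ σ) (b : ℝ) (s : ℕ) :
    ContDiff ℝ ∞ (taylorRemainder σ b s) := by
  unfold taylorRemainder
  fun_prop

/-- Differentiating the remainder of `σ` of degree `s + 1` gives the remainder of `deriv σ` of
degree `s`. -/
theorem iteratedDeriv_taylorRemainder {σ : ℝ → ℝ} (hσ : ContDiff ℝ ∞ σ) (b : ℝ) {s l : ℕ}
    (hl : l < s + 1) : iteratedDeriv l (taylorRemainder σ b s) 0 = 0 := by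
  induction l generalizing σ s with
  | zero => simp [taylorRemainder, Finset.sum_range_succ']
  | succ l ih =>
    obtain ⟨s, rfl⟩ : ∃ t, s = t + 1 := ⟨s - 1, by omega⟩
    have hd : ContDiff ℝ ∞ (deriv σ) := hσ.deriv'
    have hder : deriv (taylorRemainder σ b (s + 1)) = taylorRemainder (deriv σ) b s := by
      funext y
      have h1 : HasDerivAt (fun y => σ (b + y)) (deriv σ (b + y)) y := by
        simpa using ((hσ.differentiable (by simp) (b + y)).hasDerivAt).comp_const_add b y
      have h2 : HasDerivAt (fun y : ℝ => ∑ j ∈ Finset.range (s + 1 + 1),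
          iteratedDeriv j σ b / j.factorial * y ^ j)
          (∑ j ∈ Finset.range (s + 1 + 1),
            iteratedDeriv j σ b / j.factorial * ((j : ℝ) * y ^ (j - 1))) y :=
        HasDerivAt.fun_sum fun j _ => (hasDerivAt_pow j y).const_mul _
      refine (h1.sub h2).deriv.trans ?_
      rw [taylorRemainder, Finset.sum_range_succ']
      simp only [Nat.cast_zero, zero_mul, mul_zero, add_zero, iteratedDeriv_succ',
        Nat.add_sub_cancel]
      congr 1
      refine Finset.sum_congr rfl fun j _ => ?_
      rw [Nat.factorial_succ]
      push_cast
      field_simp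
    rw [iteratedDeriv_succ', hder]
    exact ih hd (by omega)

theorem exists_abs_le_mul_pow {φ : ℝ → ℝ} (hφ : ContDiff ℝ ∞ φ) (B : ℝ) {r : ℕ}
    (hr : ∀ l < r, iteratedDeriv l φ 0 = 0) :
    ∃ C, 0 ≤ C ∧ ∀ y, |y| ≤ B → |φ y| ≤ C * |y| ^ r := by
  induction r generalizing φ with
  | zero =>
    obtain ⟨C, hC⟩ := (isCompact_Icc (a := -B) (b := B)).exists_bound_of_continuousOn
      hφ.continuous.continuousOn
    exact ⟨|C|, abs_nonneg C, fun y hy => by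
      simpa using (hC y (abs_le.1 hy)).trans (le_abs_self C)⟩
  | succ r ih =>
    obtain ⟨C, hC, h⟩ := ih (φ := deriv φ) hφ.deriv' fun l hl => by
      rw [← iteratedDeriv_succ']
      exact hr (l + 1) (by omega)
    refine ⟨C, hC, fun y hy => ?_⟩
    have h0 : φ 0 = 0 := by simpa using hr 0 (by omega)
    have hconv : Convex ℝ (Metric.closedBall (0 : ℝ) |y|) := convex_closedBall _ _
    have := hconv.norm_image_sub_le_of_norm_deriv_le (f := φ) (C := C * |y| ^ r) (x := 0) (y := y)
      (fun t _ => hφ.differentiable (by simp) t) (fun t ht => by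
        have ht' : |t| ≤ |y| := by simpa using ht
        refine (h t (ht'.trans hy)).trans ?_
        gcongr) (by simp) (by simp)
    rw [h0, sub_zero, sub_zero, Real.norm_eq_abs, Real.norm_eq_abs] at this
    rw [pow_succ, ← mul_assoc]
    exact this

section Comp

variable {V : Type*} [NormedAddCommGroup V] [NormedSpace ℝ V] {ι : Type*} {dir : ι → V}
  {Q : Set V}

/-- If `φ` vanishes to order `r` at the origin, then all derivatives of `φ (δ • S)` are of order
`δ ^ r`. -/
theorem BoundedDerivs.exists_comp_mul {S : V → ℝ} {B : ℝ} (hB : 0 ≤ B) {k : ℕ}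
    (hS : BoundedDerivs dir Q B k S) {φ : ℝ → ℝ} (hφ : ContDiff ℝ ∞ φ) {r : ℕ}
    (hr : ∀ l < r, iteratedDeriv l φ 0 = 0) :
    ∃ C, 0 ≤ C ∧ ∀ δ ∈ Ioc (0 : ℝ) 1, BoundedDerivs dir Q (C * δ ^ r) k fun z => φ (δ * S z) := by
  have hSb := hS.abs_le
  have hb : ∀ {φ : ℝ → ℝ} {r : ℕ}, ContDiff ℝ ∞ φ → (∀ l < r, iteratedDeriv l φ 0 = 0) →
      ∃ C, 0 ≤ C ∧ ∀ δ ∈ Ioc (0 : ℝ) 1, ∀ z ∈ Q, |φ (δ * S z)| ≤ C * δ ^ r := fun {φ r} hφ hr => by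
    obtain ⟨C, hC, h⟩ := exists_abs_le_mul_pow hφ B hr
    refine ⟨C * B ^ r, by positivity, fun δ hδ z hz => ?_⟩
    have hδ0 := hδ.1
    have hSz := hSb z hz
    have h1 : |δ * S z| ≤ δ * B := by
      rw [abs_mul, abs_of_pos hδ.1]
      gcongr
    refine (h _ (h1.trans (mul_le_of_le_one_left hB hδ.2))).trans ?_
    calc C * |δ * S z| ^ r ≤ C * (δ * B) ^ r := by gcongr
      _ = _ := by rw [mul_pow]; ring
  induction k generalizing φ r with
  | zero =>
    obtain ⟨C₀, hC₀, h₀⟩ := hb hφ hr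
    exact ⟨C₀, hC₀, fun δ hδ =>
      ⟨hφ.continuous.comp_continuousOn (continuousOn_const.mul hS.1), h₀ δ hδ⟩⟩
  | succ k ih =>
    obtain ⟨C₀, hC₀, h₀⟩ := hb hφ hr
    have hr' : ∀ l < r - 1, iteratedDeriv l (deriv φ) 0 = 0 := fun l hl => by
      rw [← iteratedDeriv_succ']
      exact hr (l + 1) (by omega)
    obtain ⟨C₁, hC₁, h₁⟩ := ih hS.pred hφ.deriv' hr'
    obtain ⟨S0, S', hS', Si⟩ := hS
    refine ⟨C₀ + 2 ^ k * (C₁ * B), by positivity, fun δ hδ => ?_⟩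
    have hδ0 := hδ.1
    refine ⟨fun z hz => (h₀ δ hδ z hz).trans ?_, fun z => deriv φ (δ * S z) • δ • S' z,
      fun z hz => ?_, fun i => ?_⟩
    · gcongr
      have : 0 ≤ 2 ^ k * (C₁ * B) := by positivity
      linarith
    · exact ((hφ.differentiable (by simp) (δ * S z)).hasDerivAt).comp_hasFDerivWithinAt z
        ((hS' z hz).const_mul δ)
    · have h := (BoundedDerivs.mul (by positivity) hB (h₁ δ hδ) (Si i)).const_mul δ
      refine (h.mono_bound ?_).congr fun z _ => ?_
      · rw [abs_of_pos hδ.1]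
        -- The subtraction is truncated: for `r = 0` the claim is `δ ≤ 1`, otherwise it is an
        -- equality.
        have hpow : δ * δ ^ (r - 1) ≤ δ ^ r := by
          rcases r with _ | r
          · simpa using hδ.2
          · rw [Nat.add_sub_cancel, pow_succ, mul_comm]
        calc δ * (2 ^ k * (C₁ * δ ^ (r - 1) * B)) = 2 ^ k * (C₁ * B) * (δ * δ ^ (r - 1)) := by ring
          _ ≤ 2 ^ k * (C₁ * B) * δ ^ r := by gcongr
          _ ≤ (C₀ + 2 ^ k * (C₁ * B)) * δ ^ r := by gcongr; linarith
      · simp only [smul_apply, smul_eq_mul]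
        ring

/-- A further neuron with a small weight approximates the identity. -/
theorem BoundedDerivs.exists_approx_id {S : V → ℝ} {B : ℝ} (hB : 0 ≤ B) {k : ℕ}
    (hS : BoundedDerivs dir Q B k S) {σ : ℝ → ℝ} (hσ : ContDiff ℝ ∞ σ) {b₀ : ℝ}
    (hb₀ : iteratedDeriv 1 σ b₀ ≠ 0) {η : ℝ} (hη : 0 < η) :
    ∃ δ v c : ℝ, BoundedDerivs dir Q η k fun z => S z - (v * σ (δ * S z + b₀) + c) := by
  obtain ⟨C, hC, h⟩ := hS.exists_comp_mul hB (contDiff_taylorRemainder hσ b₀ 1)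
    fun _ h => iteratedDeriv_taylorRemainder hσ b₀ h
  set D := iteratedDeriv 1 σ b₀ with hD
  have hD0 : 0 < |D| := abs_pos.2 hb₀
  obtain ⟨δ, hδ, hδη⟩ : ∃ δ ∈ Ioc (0 : ℝ) 1, C * δ / |D| ≤ η := by
    refine ⟨min 1 (η * |D| / (C + 1)), ⟨by positivity, min_le_left _ _⟩, ?_⟩
    rw [div_le_iff₀ hD0]
    calc C * min 1 (η * |D| / (C + 1)) ≤ C * (η * |D| / (C + 1)) := by
          gcongr; exact min_le_right _ _
      _ ≤ (C + 1) * (η * |D| / (C + 1)) := by gcongr; linarith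
      _ = η * |D| := by field_simp
  have hδ0 := hδ.1
  -- The outer weight and bias invert the first-order Taylor polynomial `σ b₀ + D * δ * S`. The
  -- remainder `O(δ²)` divided by `δ * |D|` leaves `C * δ / |D|`.
  refine ⟨δ, 1 / (δ * D), -(σ b₀ / (δ * D)), ?_⟩
  refine (((h δ hδ).const_mul (-(1 / (δ * D)))).mono_bound (le_trans (le_of_eq ?_) hδη)).congr
    fun z _ => ?_
  · rw [abs_neg, abs_div, abs_one, abs_mul, abs_of_pos hδ0]
    field_simp
    ring
  · simp only [taylorRemainder, Finset.sum_range_succ, Finset.sum_range_zero, iteratedDeriv_zero,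
      Nat.factorial, Nat.cast_one, pow_zero, pow_one, ← hD, add_comm b₀]
    norm_num
    field_simp
    ring

end Comp

end Activation

/-! ### Approximation of polynomials by shallow networks -/

section Monomial

/-- Tensor-product divided differences of powers of linear forms: only one monomial survives. -/
theorem sum_tensor_coeff_mul_pow {ι : Type*} [Fintype ι] [DecidableEq ι] {n : ℕ}
    {c : Fin (n + 1) → Fin (n + 1) → ℝ}
    (hc : ∀ a : Fin (n + 1), ∀ j ≤ n, ∑ b, c a b * ((b : ℕ) : ℝ) ^ j = if j = (a : ℕ) then 1 else 0)
    (α : ι → Fin (n + 1)) (x : ι → ℝ) {j : ℕ} (hj : j ≤ ∑ i, (α i : ℕ)) :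
    ∑ β : ι → Fin (n + 1), (∏ i, c (α i) (β i)) * (∑ i, ((β i : ℕ) : ℝ) * x i) ^ j =
      if j = ∑ i, (α i : ℕ) then
        (Nat.multinomial Finset.univ fun i => (α i : ℕ)) * ∏ i, x i ^ (α i : ℕ) else 0 := by
  have h1 : ∀ γ : ι → ℕ, ∑ β : ι → Fin (n + 1), (∏ i, c (α i) (β i)) *
      ∏ i, (((β i : ℕ) : ℝ) * x i) ^ γ i =
      ∏ i, ((∑ b, c (α i) b * ((b : ℕ) : ℝ) ^ γ i) * x i ^ γ i) := fun γ => by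
    simp only [Finset.sum_mul, Fintype.prod_sum, ← Finset.prod_mul_distrib]
    exact Finset.sum_congr rfl fun β _ => Finset.prod_congr rfl fun i _ => by
      rw [mul_pow, mul_assoc]
  -- If `γ ≠ α` has total degree at most that of `α`, some `γ i < α i`, and the difference
  -- functional extracting degree `α i` kills the power `γ i`.
  have h2 : ∀ γ ∈ Finset.piAntidiag (Finset.univ : Finset ι) j, γ ≠ (fun i => (α i : ℕ)) →
      ∏ i, ((∑ b, c (α i) b * ((b : ℕ) : ℝ) ^ γ i) * x i ^ γ i) = 0 := by
    intro γ hγ hne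
    have hsum : ∑ i, γ i = j := (Finset.mem_piAntidiag.1 hγ).1
    obtain ⟨i, hi⟩ : ∃ i, γ i < α i := by
      by_contra! h
      apply hne
      have := (Finset.sum_eq_sum_iff_of_le fun i _ => h i).1
        (le_antisymm (Finset.sum_le_sum fun i _ => h i) (hsum.trans_le hj))
      exact funext fun i => (this i (Finset.mem_univ i)).symm
    refine Finset.prod_eq_zero (Finset.mem_univ i) ?_
    rw [hc (α i) (γ i) (by have := (α i).2; omega), if_neg hi.ne, zero_mul]
  simp only [Finset.sum_pow_eq_sum_piAntidiag, Finset.mul_sum]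
  rw [Finset.sum_comm]
  have h3 : ∀ γ : ι → ℕ, ∑ β : ι → Fin (n + 1), (∏ i, c (α i) (β i)) *
      ((Nat.multinomial Finset.univ γ : ℝ) * ∏ i, (((β i : ℕ) : ℝ) * x i) ^ γ i) =
      Nat.multinomial Finset.univ γ *
        ∏ i, ((∑ b, c (α i) b * ((b : ℕ) : ℝ) ^ γ i) * x i ^ γ i) := fun γ => by
    rw [← h1 γ, Finset.mul_sum]
    exact Finset.sum_congr rfl fun β _ => by ring
  simp only [h3]
  split_ifs with hjs
  · rw [Finset.sum_eq_single (fun i => (α i : ℕ)) (fun γ hγ hne => by rw [h2 γ hγ hne, mul_zero])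
      fun h => (h (Finset.mem_piAntidiag.2 ⟨hjs.symm, by simp⟩)).elim]
    congr 1
    refine Finset.prod_congr rfl fun i _ => ?_
    rw [hc (α i) (α i) (by have := (α i).2; omega), if_pos rfl, one_mul]
  · refine Finset.sum_eq_zero fun γ hγ => ?_
    rw [h2 γ hγ, mul_zero]
    rintro rfl
    exact hjs (Finset.mem_piAntidiag.1 hγ).1.symm

variable {V : Type*} [NormedAddCommGroup V] [NormedSpace ℝ V] {ι : Type*} [Fintype ι]
  {dir : ι → V} {Q : Set V}

theorem BoundedDerivs.exists_of_linear {L : V →L[ℝ] ℝ} {b : ℝ} (hb : 0 ≤ b)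
    (hL : ∀ z ∈ Q, |L z| ≤ b) (k : ℕ) : ∃ B, 0 ≤ B ∧ BoundedDerivs dir Q B k L := by
  cases k with
  | zero => exact ⟨b, hb, L.continuous.continuousOn, hL⟩
  | succ k => exact BoundedDerivs.exists_succ hb hL (fun z _ => L.hasFDerivWithinAt) fun i =>
      ⟨_, abs_nonneg _, BoundedDerivs.const (L (dir i)) le_rfl⟩

/-- Near a point where the derivatives of `σ` do not vanish, monomials are limits of linear
combinations of `(n + 1) ^ card ι` neurons, whose weights do not depend on the monomial. -/
theorem eventually_exists_approx_monomial [DecidableEq ι] {co : ι → V →L[ℝ] ℝ} {b : ℝ} (hb : 0 ≤ b)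
    (hQ : ∀ z ∈ Q, ∀ i, |co i z| ≤ b) {σ : ℝ → ℝ} (hσ : ContDiff ℝ ∞ σ) {b₀ : ℝ} {n : ℕ}
    (α : ι → Fin (n + 1)) (hσα : iteratedDeriv (∑ i, (α i : ℕ)) σ b₀ ≠ 0) (k : ℕ) {η : ℝ}
    (hη : 0 < η) :
    ∀ᶠ ε in 𝓝[>] (0 : ℝ), ∃ a : (ι → Fin (n + 1)) → ℝ, BoundedDerivs dir Q η k fun z =>
      ∏ i, co i z ^ (α i : ℕ) - ∑ β, a β * σ (b₀ + ε * ∑ i, ((β i : ℕ) : ℝ) * co i z) := by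
  have hinj : Function.Injective fun b : Fin (n + 1) => ((b : ℕ) : ℝ) := fun i j hij =>
    Fin.ext (Nat.cast_injective (R := ℝ) hij)
  choose c hc using fun a : Fin (n + 1) => exists_interpolation_coeffs hinj (a : ℕ)
  set s := ∑ i, (α i : ℕ) with hs
  set w : (ι → Fin (n + 1)) → ℝ := fun β => ∏ i, c (α i) (β i) with hw
  let l : (ι → Fin (n + 1)) → V →L[ℝ] ℝ := fun β => ∑ i, ((β i : ℕ) : ℝ) • co i
  have hl : ∀ β z, l β z = ∑ i, ((β i : ℕ) : ℝ) * co i z := fun β z => by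
    simp [l, sum_apply]
  have hlb : ∀ β, ∃ B, 0 ≤ B ∧ BoundedDerivs dir Q B k (l β) := fun β => by
    refine BoundedDerivs.exists_of_linear (b := ∑ i, ((β i : ℕ) : ℝ) * b) (by positivity)
      (fun z hz => ?_) k
    rw [hl]
    refine (Finset.abs_sum_le_sum_abs _ _).trans (Finset.sum_le_sum fun i _ => ?_)
    rw [abs_mul, abs_of_nonneg (Nat.cast_nonneg _)]
    exact mul_le_mul_of_nonneg_left (hQ z hz i) (Nat.cast_nonneg _)
  choose B hB hlB using hlb
  choose C hC hCb using fun β => (hlB β).exists_comp_mul (hB β)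
    (contDiff_taylorRemainder hσ b₀ s) fun _ h => iteratedDeriv_taylorRemainder hσ b₀ h
  set mult : ℝ := ((Nat.multinomial Finset.univ fun i => (α i : ℕ) : ℕ) : ℝ) with hmult
  have hmult0 : mult ≠ 0 := by
    rw [hmult]; exact_mod_cast (Nat.multinomial_pos _ _).ne'
  set θ : ℝ := iteratedDeriv s σ b₀ / s.factorial * mult with hθ
  have hθ0 : θ ≠ 0 := mul_ne_zero (div_ne_zero hσα (by positivity)) hmult0
  -- After Taylor expansion of `σ` at `b₀`, the terms of degree below `s` cancel and degree `s`
  -- leaves only the wanted monomial. The remainders are `O(ε ^ (s + 1))`, so dividing by `θ * ε ^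
  -- s` leaves an error `O(ε)`.
  have hexp : ∀ (ε : ℝ) (z : V), ∑ β, w β * σ (b₀ + ε * l β z) =
      θ * ε ^ s * ∏ i, co i z ^ (α i : ℕ) +
        ∑ β, w β * taylorRemainder σ b₀ s (ε * l β z) := fun ε z => by
    have h1 : ∀ β, w β * σ (b₀ + ε * l β z) =
        ∑ j ∈ Finset.range (s + 1), iteratedDeriv j σ b₀ / j.factorial * ε ^ j *
          (w β * l β z ^ j) + w β * taylorRemainder σ b₀ s (ε * l β z) := fun β => by
      rw [taylorRemainder, mul_sub, Finset.mul_sum, ← add_sub_assoc, add_sub_right_comm]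
      rw [← Finset.sum_sub_distrib, Finset.sum_eq_zero, zero_add]
      intro j _
      rw [mul_pow]
      ring
    simp only [h1, Finset.sum_add_distrib]
    congr 1
    rw [Finset.sum_comm]
    simp only [← Finset.mul_sum]
    have h2 : ∀ j ∈ Finset.range (s + 1), iteratedDeriv j σ b₀ / j.factorial * ε ^ j *
        ∑ β, w β * l β z ^ j = if j = s then θ * ε ^ s * ∏ i, co i z ^ (α i : ℕ) else 0 := by
      intro j hj
      simp only [hl, hw]
      rw [sum_tensor_coeff_mul_pow hc α (fun i => co i z) (by
        rw [Finset.mem_range] at hj; omega)]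
      split_ifs with h
      · rw [h, hθ, hmult]
        ring
      · rw [mul_zero]
    rw [Finset.sum_congr rfl h2, Finset.sum_ite_eq' (Finset.range (s + 1)) s, if_pos (by simp)]
  have hlim : Filter.Tendsto (fun ε : ℝ => ∑ β, |w β| * (C β * ε) / |θ|) (𝓝[>] 0) (𝓝 0) := by
    have hcont : Continuous fun ε : ℝ => ∑ β, |w β| * (C β * ε) / |θ| := by fun_prop
    simpa using (hcont.tendsto 0).mono_left nhdsWithin_le_nhds
  filter_upwards [hlim.eventually_lt_const hη, Ioc_mem_nhdsGT (zero_lt_one' ℝ)] with ε hε hε1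
  have hε0 := hε1.1
  have hne : θ * ε ^ s ≠ 0 := mul_ne_zero hθ0 (pow_ne_zero s hε0.ne')
  refine ⟨fun β => w β / (θ * ε ^ s), ?_⟩
  have hsum := BoundedDerivs.sum Finset.univ fun β _ =>
    ((hCb β ε hε1).const_mul (-(w β / (θ * ε ^ s))))
  refine (hsum.mono_bound (le_trans (le_of_eq ?_) hε.le)).congr fun z _ => ?_
  · refine Finset.sum_congr rfl fun β _ => ?_
    rw [abs_neg, abs_div, abs_mul, abs_of_pos (pow_pos hε0 s), pow_succ]
    have : |θ| ≠ 0 := abs_ne_zero.2 hθ0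
    have : ε ^ s ≠ 0 := pow_ne_zero s hε0.ne'
    field_simp
  · have h := hexp ε z
    have h4 : ∑ β, w β / (θ * ε ^ s) * σ (b₀ + ε * l β z) =
        (∑ β, w β * σ (b₀ + ε * l β z)) / (θ * ε ^ s) := by
      rw [Finset.sum_div]
      exact Finset.sum_congr rfl fun β _ => by ring
    have h5 : ∑ β, -(w β / (θ * ε ^ s)) * taylorRemainder σ b₀ s (ε * l β z) =
        -((∑ β, w β * taylorRemainder σ b₀ s (ε * l β z)) / (θ * ε ^ s)) := by
      rw [Finset.sum_div, ← Finset.sum_neg_distrib]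
      exact Finset.sum_congr rfl fun β _ => by ring
    simp only [← hl]
    rw [h4, h5, h, add_div, mul_div_cancel_left₀ _ hne]
    ring

/-- All monomials must share the same inner weights `ε * β`, or the number of neurons would be
squared. As each monomial is approximated for all small `ε`, and there are finitely many, one `ε`
serves them all. -/
theorem exists_approx_polynomial [DecidableEq ι] {co : ι → V →L[ℝ] ℝ} {b : ℝ} (hb : 0 ≤ b)
    (hQ : ∀ z ∈ Q, ∀ i, |co i z| ≤ b) {σ : ℝ → ℝ} (hσ : ContDiff ℝ ∞ σ) {b₀ : ℝ} {n : ℕ}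
    (hσ₀ : ∀ j ≤ Fintype.card ι * n, iteratedDeriv j σ b₀ ≠ 0) (k : ℕ)
    (p : (ι → Fin (n + 1)) → ℝ) {η : ℝ} (hη : 0 < η) :
    ∃ (ε : ℝ) (a : (ι → Fin (n + 1)) → ℝ), BoundedDerivs dir Q η k fun z =>
      ∑ α, p α * ∏ i, co i z ^ (α i : ℕ) -
        ∑ β, a β * σ (b₀ + ε * ∑ i, ((β i : ℕ) : ℝ) * co i z) := by
  set P : ℝ := ∑ α, |p α| with hP
  have hP0 : 0 ≤ P := Finset.sum_nonneg fun _ _ => abs_nonneg _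
  have hη' : 0 < η / (P + 1) := by positivity
  have hev := Filter.eventually_all.2 fun α : ι → Fin (n + 1) =>
    eventually_exists_approx_monomial (dir := dir) hb hQ hσ α (b₀ := b₀) (hσ₀ _ (by
      refine (Finset.sum_le_sum fun i _ => Nat.lt_succ_iff.1 (α i).2).trans ?_
      simp)) k hη'
  obtain ⟨ε, hε⟩ := hev.exists
  choose a ha using hε
  refine ⟨ε, fun β => ∑ α, p α * a α β, ?_⟩
  have h := BoundedDerivs.sum Finset.univ fun α _ => (ha α).const_mul (p α)
  refine (h.mono_bound ?_).congr fun z _ => ?_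
  · rw [← Finset.sum_mul, ← hP, mul_div_assoc', div_le_iff₀ (by positivity)]
    nlinarith
  · simp only [mul_sub, Finset.sum_sub_distrib, Finset.mul_sum, Finset.sum_mul]
    congr 1
    rw [Finset.sum_comm]
    exact Finset.sum_congr rfl fun α _ => Finset.sum_congr rfl fun β _ => by ring

end Monomial

/-! ### Networks with two hidden layers and prescribed complexity -/

section Network

open Classical in
theorem ncard_cons {P : ℕ} (x : ℝ) (g : Fin P → ℝ) :
    {i | (Fin.cons x g : Fin (P + 1) → ℝ) i ≠ 0}.ncard =
      (if x = 0 then 0 else 1) + {i | g i ≠ 0}.ncard := by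
  simp only [Set.ncard_eq_toFinset_card', Set.toFinset_ofPred, Finset.card_filter,
    Fin.sum_univ_succ, Fin.cons_zero, Fin.cons_succ]
  split_ifs <;> simp_all

open Classical in
/-- A network with two hidden layers, the second of which has one active neuron, and inactive neurons
that adjust the complexity. -/
theorem exists_network_of_le {D m N : ℕ} (W : Matrix (Fin m) (Fin D) ℝ) (b₁ a : Fin m → ℝ)
    (b₂ v c : ℝ)
    (hN : {p : Fin m × Fin D | W p.1 p.2 ≠ 0}.ncard + {i | b₁ i ≠ 0}.ncard + {i | a i ≠ 0}.ncard +
      (if b₂ = 0 then 0 else 1) + (if v = 0 then 0 else 1) + (if c = 0 then 0 else 1) ≤ N) :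
    ∃ Φ : NeuralNetwork D, 2 ≤ Φ.depth ∧ Φ.complexity = N ∧ ∀ (σ : ℝ → ℝ) (x : Fin D → ℝ),
      Φ.eval σ x = v * σ (∑ i, a i * σ (W.mulVec x i + b₁ i) + b₂) + c := by
  set c₀ := {p : Fin m × Fin D | W p.1 p.2 ≠ 0}.ncard + {i | b₁ i ≠ 0}.ncard +
    {i | a i ≠ 0}.ncard + (if b₂ = 0 then 0 else 1) + (if v = 0 then 0 else 1) +
      (if c = 0 then 0 else 1) with hc₀
  -- The missing `P` parameters are biases `1` of second-layer neurons with no incoming or outgoing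
  -- weights: each counts once and none affects the output.
  let P := N - c₀
  let W₂ : Matrix (Fin (P + 1)) (Fin m) ℝ := Matrix.of (Fin.cons a fun _ => 0)
  refine ⟨.hidden W b₁ (.hidden W₂ (Fin.cons b₂ fun _ => 1) (.output (Fin.cons v fun _ => 0) c)),
    by simp [NeuralNetwork.depth], ?_, fun σ x => ?_⟩
  · have h1 : {p : Fin (P + 1) × Fin m | W₂ p.1 p.2 ≠ 0} =
        (fun j => ((0 : Fin (P + 1)), j)) '' {j | a j ≠ 0} := by
      ext ⟨i, j⟩
      refine Fin.cases ?_ (fun i => ?_) i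
      · simp [W₂]
      · simp [W₂, (Fin.succ_ne_zero i).symm]
    have h2 : {p : Fin (P + 1) × Fin m | W₂ p.1 p.2 ≠ 0}.ncard = {j | a j ≠ 0}.ncard := by
      rw [h1, Set.ncard_image_of_injective _ fun i j hij => (Prod.ext_iff.1 hij).2]
    simp only [NeuralNetwork.complexity, h2, ncard_cons]
    have h3 : {i : Fin P | (1 : ℝ) ≠ 0}.ncard = P := by simp [Set.ncard_univ]
    have h4 : {i : Fin P | (0 : ℝ) ≠ 0}.ncard = 0 := by simp
    rw [h3, h4]
    omega
  · simp [NeuralNetwork.eval, dotProduct, Fin.sum_univ_succ, W₂, Matrix.mulVec]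

end Network

/-! ### Approximation by neural networks -/

section Main

theorem coordFun_sum_smul_coordDir {d : ℕ} (u : Fin (d + 1) → ℝ) (i : Fin (d + 1)) :
    coordFun d i (∑ j, u j • coordDir d j) = u i := by
  rw [Fin.sum_univ_succ]
  simp only [coordFun, coordDir, Fin.cons_zero, Fin.cons_succ]
  refine Fin.cases ?_ (fun i => ?_) i
  · simp [Prod.fst_sum]
  · simp [Prod.snd_sum]

theorem abs_coordFun_le {d : ℕ} (i : Fin (d + 1)) (z : SpaceTime d) : |coordFun d i z| ≤ ‖z‖ := by
  refine Fin.cases ?_ (fun i => ?_) i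
  · exact norm_fst_le z
  · exact (PiLp.norm_apply_le z.2 i).trans (norm_snd_le z)

theorem cons_eq_coordFun {d : ℕ} (z : SpaceTime d) :
    (Fin.cons z.1 (fun i => z.2 i) : Fin (d + 1) → ℝ) = fun i => coordFun d i z :=
  funext fun i => Fin.cases rfl (fun _ => rfl) i

/-- Three errors add up: Jackson's, and an arbitrary `η` each for the shallow network and for the
neuron imitating the identity. Each first-layer neuron costs `d + 1` weights, one bias and one
outgoing weight, hence `d + 3`; the second bias, the output weight and the output bias cost `3`. -/
theorem exists_network_approx {d k n N : ℕ} {b M η : ℝ} (hb : 0 < b) (hM : 0 ≤ M) (hη : 0 < η)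
    {σ : ℝ → ℝ} (hσ : ContDiff ℝ ∞ σ) (hp : ¬ ∃ p : Polynomial ℝ, ∀ y, σ y = p.eval y)
    {F : SpaceTime d → ℝ} (hF : BoundedDerivs (coordDir d) univ M (k + 1) F)
    (hsupp : ∀ z, F z ≠ 0 → ∀ i, |coordFun d i z| ≤ b) (hn : 1 ≤ n)
    (hN : (d + 3) * (8 * n + 1) ^ (d + 1) + 3 ≤ N) :
    ∃ Φ : NeuralNetwork (d + 1), 2 ≤ Φ.depth ∧ Φ.complexity = N ∧
      BoundedDerivs (coordDir d) {z | ∀ i, |coordFun d i z| ≤ b}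
        ((d + 1) * (129 * (2 * b) / n) * M + (η + η)) k (fun z => F z - Φ.realize σ z) := by
  -- The tensor monomials have total degree up to `(d + 1) * (8 * n)`, and each needs a nonzero
  -- derivative of that order.
  obtain ⟨b₀, hb₀⟩ := exists_iteratedDeriv_ne_zero hσ hp
    (Fintype.card (Fin (d + 1)) * (8 * n))
  obtain ⟨p, hp₁⟩ := hF.exists_polynomial_approx hb hM sum_coordFun_smul_coordDir
    coordFun_sum_smul_coordDir hsupp hn
  obtain ⟨ε, a, h₂⟩ := exists_approx_polynomial (dir := coordDir d) (co := coordFun d)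
    (Q := {z | ∀ i, |coordFun d i z| ≤ b}) hb.le (fun z hz => hz) hσ hb₀ k p hη
  set E₁ : ℝ := Fintype.card (Fin (d + 1)) * (129 * (2 * b) / n) * M with hE₁
  have hE₁0 : 0 ≤ E₁ := by positivity
  set S : SpaceTime d → ℝ := fun z =>
    ∑ β, a β * σ (b₀ + ε * ∑ i, ((β i : ℕ) : ℝ) * coordFun d i z) with hS
  have h₁₂ := hp₁.add h₂
  have hFS : BoundedDerivs (coordDir d) {z | ∀ i, |coordFun d i z| ≤ b} (E₁ + η) k
      (fun z => F z - S z) := h₁₂.congr fun z _ => by simp only [hS]; ring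
  have hSb : BoundedDerivs (coordDir d) {z | ∀ i, |coordFun d i z| ≤ b} (M + (E₁ + η)) k S :=
    ((hF.pred.mono_set (subset_univ _)).sub hFS).congr fun z _ => by ring
  obtain ⟨δ, v, c, h₃⟩ := hSb.exists_approx_id (by positivity) hσ (hb₀ 1 (by
    rw [Fintype.card_fin]; nlinarith)) hη
  let e : Fin ((8 * n + 1) ^ (d + 1)) ≃ (Fin (d + 1) → Fin (8 * n + 1)) := finFunctionFinEquiv.symm
  obtain ⟨Φ, hdepth, hcomp, heval⟩ := exists_network_of_le (N := N)
    (Matrix.of fun i j => ε * ((e i j : ℕ) : ℝ)) (fun _ => b₀) (fun i => δ * a (e i)) b₀ v c (by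
      refine le_trans ?_ hN
      have h1 : ∀ s : Set (Fin ((8 * n + 1) ^ (d + 1))), s.ncard ≤ (8 * n + 1) ^ (d + 1) :=
        fun s => (Set.ncard_le_card s).trans (by simp)
      have h2 : ∀ s : Set (Fin ((8 * n + 1) ^ (d + 1)) × Fin (d + 1)),
          s.ncard ≤ (8 * n + 1) ^ (d + 1) * (d + 1) :=
        fun s => (Set.ncard_le_card s).trans (by simp)
      have h3 : ∀ x : ℝ, (if x = 0 then 0 else 1) ≤ 1 := fun x => by split_ifs <;> simp
      calc _ ≤ (8 * n + 1) ^ (d + 1) * (d + 1) + (8 * n + 1) ^ (d + 1) + (8 * n + 1) ^ (d + 1) +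
            1 + 1 + 1 := by
            gcongr
            · exact h2 _
            · exact h1 _
            · exact h1 _
            · exact h3 _
            · exact h3 _
            · exact h3 _
        _ = _ := by ring)
  refine ⟨Φ, hdepth, hcomp, ?_⟩
  have hreal : ∀ z, Φ.realize σ z = v * σ (δ * S z + b₀) + c := fun z => by
    rw [NeuralNetwork.realize, heval, cons_eq_coordFun]
    congr 3
    rw [hS, Finset.mul_sum, ← e.sum_comp]
    congr 1
    refine Finset.sum_congr rfl fun i _ => ?_
    rw [mul_assoc]
    congr 3
    rw [add_comm]
    congr 1
    simp only [Matrix.mulVec, dotProduct, Matrix.of_apply, Finset.mul_sum, mul_assoc]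
  refine ((hFS.add h₃).mono_bound (le_of_eq ?_)).congr fun z _ => ?_
  · rw [hE₁, Fintype.card_fin]
    push_cast
    ring
  · rw [hreal]
    ring

/-- Serves the degenerate cases of the theorem, in particular those `N` too small to afford any
approximation. -/
theorem exists_zero_network (D : ℕ) (N : ℕ) :
    ∃ Φ : NeuralNetwork D, 2 ≤ Φ.depth ∧ Φ.complexity = N ∧
      ∀ (σ : ℝ → ℝ) (x : Fin D → ℝ), Φ.eval σ x = 0 := by
  obtain ⟨Φ, h1, h2, h3⟩ := exists_network_of_le (N := N) (0 : Matrix (Fin 0) (Fin D) ℝ) 0 0 0 0 0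
    (by simp)
  exact ⟨Φ, h1, h2, fun σ x => by simp [h3]⟩

/-- The number of nodes affordable with `N` parameters. -/
theorem exists_resolution {c D N : ℕ} (hc : 0 < c) (hD : 0 < D) (hN : 1 ≤ N) :
    (1 ≤ (c : ℝ) ^ (1 / (D : ℝ)) * (N : ℝ) ^ (-(1 / (D : ℝ)))) ∨
      ∃ n : ℕ, 1 ≤ n ∧ c * n ^ D ≤ N ∧
        1 / (n : ℝ) ≤ 2 * ((c : ℝ) ^ (1 / (D : ℝ)) * (N : ℝ) ^ (-(1 / (D : ℝ)))) := by
  have hc' : (0 : ℝ) < c := by exact_mod_cast hc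
  have hN' : (0 : ℝ) < N := by exact_mod_cast hN
  set x : ℝ := ((N : ℝ) / c) ^ (1 / (D : ℝ)) with hx
  have hx0 : 0 < x := by positivity
  have hinv : (c : ℝ) ^ (1 / (D : ℝ)) * (N : ℝ) ^ (-(1 / (D : ℝ))) = 1 / x := by
    rw [hx, Real.div_rpow hN'.le hc'.le, Real.rpow_neg hN'.le, one_div_div, ← div_eq_mul_inv]
  have hxD : x ^ D = (N : ℝ) / c := by
    rw [hx, one_div]
    exact Real.rpow_inv_natCast_pow (by positivity) hD.ne'
  rw [hinv]
  rcases le_or_gt x 1 with h | h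
  · exact Or.inl ((one_le_div hx0).2 h)
  -- Take `n = ⌊x⌋₊` with `x = (N / c) ^ (1 / D) > 1`; then `x < n + 1 ≤ 2 * n`, which is the factor
  -- `2`.
  · have hfl : 1 ≤ ⌊x⌋₊ := (Nat.one_le_floor_iff x).2 h.le
    have hn1 : (1 : ℝ) ≤ ⌊x⌋₊ := by exact_mod_cast hfl
    refine Or.inr ⟨⌊x⌋₊, hfl, ?_, ?_⟩
    · have h1 : ((⌊x⌋₊ : ℝ)) ^ D ≤ x ^ D := by
        gcongr
        exact Nat.floor_le hx0.le
      rw [hxD, le_div_iff₀ hc'] at h1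
      have : ((c * ⌊x⌋₊ ^ D : ℕ) : ℝ) ≤ N := by
        push_cast
        linarith
      exact_mod_cast this
    · have h2 := Nat.lt_floor_add_one x
      rw [mul_one_div, div_le_div_iff₀ (by linarith) hx0]
      linarith

end Main

theorem proposition3p1 (d : ℕ) (Ω : Set (EuclideanSpace ℝ (Fin d)))
    (hΩ : IsSmoothBoundedDomain Ω) (T : ℝ) (hT : 0 < T) (k : ℕ) :
    ∃ C : ℝ, 0 < C ∧
      ∀ σ : ℝ → ℝ, ContDiff ℝ ∞ σ → (¬ ∃ p : Polynomial ℝ, ∀ y, σ y = p.eval y) →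
      ∀ f : SpaceTime d → ℝ, ContDiffOn ℝ (k + 1) f (Icc 0 T ×ˢ closure Ω) →
      ∀ N : ℕ, 1 ≤ N →
        ∃ Φ : NeuralNetwork (d + 1), 2 ≤ Φ.depth ∧ Φ.complexity = N ∧
          sobolevNorm k (Ioo 0 T ×ˢ Ω) (fun z => f z - Φ.realize σ z) ≤
            ENNReal.ofReal (C * (N : ℝ) ^ (-(1 / ((d : ℝ) + 1)))) *
              sobolevNorm (k + 1) (Ioo 0 T ×ˢ Ω) f := by
  have hQo : IsOpen (Ioo 0 T ×ˢ Ω) := isOpen_Ioo.prod hΩ.isOpen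
  have hQS : Ioo 0 T ×ˢ Ω ⊆ Icc 0 T ×ˢ closure Ω := prod_mono Ioo_subset_Icc_self subset_closure
  have hSQ : Icc 0 T ×ˢ closure Ω ⊆ closure (Ioo 0 T ×ˢ Ω) := by
    rw [closure_prod_eq, closure_Ioo hT.ne]
  have hSu : UniqueDiffOn ℝ (Icc 0 T ×ˢ closure Ω) :=
    (uniqueDiffOn_Icc hT).prod hΩ.uniqueDiffOn_closure
  obtain ⟨K, R, hK, hext⟩ := hΩ.exists_extension hT (k + 1)
  obtain ⟨R', hR'⟩ := ((Metric.isBounded_Icc 0 T).prod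
    hΩ.isBounded.isCompact_closure.isBounded).exists_norm_le
  -- The box must contain the support of every extension (`R`) as well as the cylinder itself
  -- (`R'`).
  set b : ℝ := |R| + |R'| + 1 with hbdef
  have hb : 0 < b := by positivity
  -- From `8 n + 1 ≤ 9 n` and `3 ≤ 3 n ^ (d + 1)`, the network for resolution `n` needs at most `c *
  -- n ^ (d + 1)` parameters.
  set c : ℕ := (d + 3) * 9 ^ (d + 1) + 3 with hc
  -- The summand `1` absorbs the two errors `η = M / n / 2` made in imitating the polynomial.
  set A : ℝ := (d + 1) * (129 * (2 * b)) * K + 1 with hA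
  have hA1 : 1 ≤ A := by
    have : 0 ≤ (d + 1) * (129 * (2 * b)) * K := by positivity
    linarith
  have hcpos : 0 < (c : ℝ) ^ (1 / ((d : ℝ) + 1)) := by positivity
  refine ⟨2 * (c : ℝ) ^ (1 / ((d : ℝ) + 1)) * A, by positivity, fun σ hσ hp f hf N hN => ?_⟩
  have hNpos : (0 : ℝ) < N := by exact_mod_cast hN
  set t : ℝ := (N : ℝ) ^ (-(1 / ((d : ℝ) + 1))) with ht
  have ht0 : 0 < t := by positivity
  obtain ⟨Φ₀, hd₀, hc₀, he₀⟩ := exists_zero_network (d + 1) N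
  have hf₀ : (fun z => f z - Φ₀.realize σ z) = f := by
    funext z
    rw [NeuralNetwork.realize, he₀, sub_zero]
  have hmono : sobolevNorm k (Ioo 0 T ×ˢ Ω) f ≤ sobolevNorm (k + 1) (Ioo 0 T ×ˢ Ω) f :=
    sobolevNorm_mono (Nat.le_succ k) f
  -- An infinite norm makes the right-hand side infinite, so finiteness need not be proved. A zero
  -- norm is split off because `η` must be positive.
  rcases eq_or_ne (sobolevNorm (k + 1) (Ioo 0 T ×ˢ Ω) f) ⊤ with htop | htop
  · refine ⟨Φ₀, hd₀, hc₀, ?_⟩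
    rw [htop, ENNReal.mul_top (ENNReal.ofReal_pos.2 (by positivity)).ne']
    exact le_top
  rcases eq_or_ne (sobolevNorm (k + 1) (Ioo 0 T ×ˢ Ω) f) 0 with hzero | hzero
  · refine ⟨Φ₀, hd₀, hc₀, ?_⟩
    rw [hf₀, hzero, mul_zero]
    exact hmono.trans hzero.le
  have hres := exists_resolution (c := c) (D := d + 1) (N := N) (by omega) (by omega) hN
  push_cast at hres
  rw [← ht] at hres
  rcases hres with hsmall | ⟨n, hn, hnN, hnt⟩
  -- Here `N` is so small that the factor in front of the norm is at least `1`, and the zero network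
  -- suffices.
  · refine ⟨Φ₀, hd₀, hc₀, ?_⟩
    rw [hf₀]
    refine hmono.trans (le_mul_of_one_le_left zero_le ?_)
    rw [← ENNReal.ofReal_one]
    refine ENNReal.ofReal_le_ofReal ?_
    nlinarith [mul_le_mul_of_nonneg_left hA1 (mul_pos hcpos ht0).le]
  set M : ℝ := (sobolevNorm (k + 1) (Ioo 0 T ×ˢ Ω) f).toReal with hM
  have hM0 : 0 < M := ENNReal.toReal_pos hzero htop
  have hnpos : (0 : ℝ) < n := by exact_mod_cast hn
  have hfb : BoundedDerivs (coordDir d) (Icc 0 T ×ˢ closure Ω) M (k + 1) f :=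
    boundedDerivs_of_sobolevNorm_le hQo hQS hSQ hSu hM0.le (by exact_mod_cast hf)
      (ENNReal.ofReal_toReal htop).ge
  obtain ⟨F, hFf, hFb, hFs⟩ := hext f M hM0.le hfb
  obtain ⟨Φ, hdepth, hcomp, happ⟩ := exists_network_approx (N := N) (n := n) hb
    (mul_nonneg hK hM0.le) (η := M / n / 2) (by positivity) hσ hp hFb
    (fun z hz i => (abs_coordFun_le i z).trans
      ((hFs z hz).trans (by linarith [le_abs_self R, abs_nonneg R']))) hn (by
      refine le_trans ?_ hnN
      have h1 : (8 * n + 1) ^ (d + 1) ≤ (9 * n) ^ (d + 1) := Nat.pow_le_pow_left (by omega) _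
      have h2 : 1 ≤ n ^ (d + 1) := Nat.one_le_pow _ _ hn
      calc (d + 3) * (8 * n + 1) ^ (d + 1) + 3 ≤ (d + 3) * (9 * n) ^ (d + 1) + 3 * n ^ (d + 1) := by
            gcongr
            omega
        _ = c * n ^ (d + 1) := by rw [hc, mul_pow]; ring)
  refine ⟨Φ, hdepth, hcomp, ?_⟩
  have hQb : Ioo 0 T ×ˢ Ω ⊆ {z | ∀ i, |coordFun d i z| ≤ b} := fun z hz i =>
    (abs_coordFun_le i z).trans
      ((hR' z (hQS hz)).trans (by linarith [le_abs_self R', abs_nonneg R]))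
  have hfinal : BoundedDerivs (coordDir d) (Ioo 0 T ×ˢ Ω)
      (2 * (c : ℝ) ^ (1 / ((d : ℝ) + 1)) * A * t * M) k (fun z => f z - Φ.realize σ z) := by
    refine ((happ.mono_set hQb).mono_bound ?_).congr fun z hz => ?_
    · calc (d + 1) * (129 * (2 * b) / n) * (K * M) + (M / n / 2 + M / n / 2)
          = A * M * (1 / n) := by rw [hA]; ring
        _ ≤ A * M * (2 * ((c : ℝ) ^ (1 / ((d : ℝ) + 1)) * t)) := by gcongr
        _ = _ := by ring
    · simp only [hFf (hQS hz)]
  refine (hfinal.sobolevNorm_le hQo).trans (le_of_eq ?_)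
  rw [ENNReal.ofReal_mul (by positivity), hM, ENNReal.ofReal_toReal htop]
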